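/- Let $t_0>0$, let $m\ge 0$ be an integer, and let $\mathbf a_m(t)=(t_0-t)^m\,\mathbb 1_+(t_0-t)$, where $\mathbb 1_+$ is the characteristic function of $\mathbb R_+=(0,\infty)$. Let $\mathbf\Gamma(\mathbf a_m)$ be the integral Hankel operator with kernel $\mathbf a_m$ in the complex Hilbert space $L^2(\mathbb R_+)$, that is, the bounded operator determined by $$(\mathbf\Gamma(\mathbf a_m)u)(t)=\int_0^\infty \mathbf a_m(t+s)\,u(s)\,ds,\qquad u\in C_0^\infty(\mathbb R_+).$$ For a compact operator $T$ let $s_1(T)\ge s_2(T)\ge\cdots$ be its singular values, that is, the eigenvalues of $|T|=\sqrt{T^*T}$ in non-increasing order, counted with multiplicity (the positive eigenvalues, continued by zeros if there are only finitely many of them). Then $\mathbf\Gamma(\mathbf a_m)$ is well defined, bounded and compact, and $$s_n(\mathbf\Gamma(\mathbf a_m))=m!\,t_0^{m+1}(\pi n)^{-m-1}\bigl(1+O(n^{-1})\bigr),\qquad n\to\infty.$$ The constant implied in $O(n^{-1})$ may depend on $m$ and $t_0$. -/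

import Mathlib

open MeasureTheory Set Filter Asymptotics
open scoped ContDiff Topology

noncomputable section

/-- The complex Hilbert space `L²(ℝ₊)`, where `ℝ₊ = (0, ∞)` carries Lebesgue measure. -/
abbrev L2HalfLine : Type := Lp ℂ 2 (volume.restrict (Ioi (0 : ℝ)))

/-- The bounded operator `T` on `L²(ℝ₊)` is the integral Hankel operator with kernel `h`:
`h` is locally integrable on `ℝ₊`, and `(T u)(t) = ∫₀^∞ h(t + s) u(s) ds` for almost every `t > 0`,
for every smooth function `u` with compact support contained in `ℝ₊`
(such functions are dense in `L²(ℝ₊)`, so there is at most one such `T`). -/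
structure IsHankelOperator (h : ℝ → ℂ) (T : L2HalfLine →L[ℂ] L2HalfLine) : Prop where
  locallyIntegrableOn : LocallyIntegrableOn h (Ioi (0 : ℝ)) volume
  apply_test : ∀ u : ℝ → ℂ, ContDiff ℝ ∞ u → HasCompactSupport u → tsupport u ⊆ Ioi (0 : ℝ) →
    ∀ f : L2HalfLine, (f : ℝ → ℂ) =ᵐ[volume.restrict (Ioi (0 : ℝ))] u →
      (T f : ℝ → ℂ) =ᵐ[volume.restrict (Ioi (0 : ℝ))]
        fun t => ∫ s in Ioi (0 : ℝ), h (t + s) * u s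

/-- `s 1 ≥ s 2 ≥ …` is the sequence of singular values of the operator `T` on a Hilbert space:
the non-increasing enumeration, counted with multiplicity, of the positive eigenvalues of
`|T| = √(T* T)`, continued by zeros if there are only finitely many of them. -/
structure IsSingularValueSequence {H : Type*} [NormedAddCommGroup H] [InnerProductSpace ℂ H]
    [CompleteSpace H] (T : H →L[ℂ] H) (s : ℕ+ → ℝ) : Prop where
  antitone : Antitone s
  nonneg : ∀ n, 0 ≤ s n
  encard_eq : ∀ μ : ℝ, 0 < μ → {n : ℕ+ | s n = μ}.encard =
    Cardinal.toENat (Module.rank ℂ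
      (Module.End.eigenspace ((CFC.abs T : H →L[ℂ] H) : H →ₗ[ℂ] H) (μ : ℂ)))

/-- The kernel `a_m(t) = (t₀ - t)^m 𝟙₊(t₀ - t)`, with `𝟙₊` the characteristic function of `ℝ₊`. -/
def truncatedPower (m : ℕ) (t₀ t : ℝ) : ℂ :=
  ((t₀ - t) ^ m * (Ioi (0 : ℝ)).indicator (fun _ => (1 : ℝ)) (t₀ - t) : ℝ)

end

/-! ### Dimension comparison and eigenspaces of compact operators -/

section HilbertSpace

variable {H : Type*} [NormedAddCommGroup H] [InnerProductSpace ℂ H]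

/-! The operator lives on `(0, t₀]`, and up to finitely many dimensions it is a Fourier multiplier
there. The integral of `exp (c t) (y - t)^m` over `(0, y)` is a polynomial in `y` of degree at most
`m + 1` plus `m! / c^(m+1) * exp (c y)`. With `y = t₀ - s` and a `t₀`-periodic exponential this
describes the action of the kernel on each Fourier mode. For `v` orthogonal to the monomials of
degree below `m + 2` the polynomial drops out, so the `n`-th coefficient of the image is the
`(-n)`-th coefficient of `v` times a multiplier of modulus `m! (t₀ / (2π|n|))^(m+1)`
(`fourierInt_hankelOperator`). Parseval then gives the norm of the image exactly
(`hasSum_hankelOperator`).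

Singular values follow by min-max (`singularValue_le`, `le_singularValue`). Modes with `|k| ≤ N`
together with the polynomials span a space of dimension at most `2N + m + 3`, outside which the
operator is bounded by the multiplier at `N + 1`. Modes with `0 < |k| ≤ N`, made orthogonal to the
polynomials, span at least `2N - m - 2` dimensions, on which it is bounded below by the multiplier
at `N`. Hence `2N = n + O(1)`, and a bounded shift of the index costs a relative error `O(1/n)`. -/

theorem Submodule.finrank_le_finrank_inf_orthogonal_add (V P : Submodule ℂ H)
    [FiniteDimensional ℂ V] [FiniteDimensional ℂ P] :
    Module.finrank ℂ V ≤ Module.finrank ℂ (V ⊓ Pᗮ : Submodule ℂ H) + Module.finrank ℂ P := by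
  let f : V →ₗ[ℂ] P := (P.orthogonalProjectionOnto : H →ₗ[ℂ] P) ∘ₗ V.subtype
  have h1 := f.finrank_range_add_finrank_ker
  have h2 : Module.finrank ℂ (LinearMap.range f) ≤ Module.finrank ℂ P := Submodule.finrank_le _
  have h3 : Module.finrank ℂ (LinearMap.ker f) ≤ Module.finrank ℂ (V ⊓ Pᗮ : Submodule ℂ H) := by
    have h4 : (LinearMap.ker f).map V.subtype ≤ V ⊓ Pᗮ := by
      rintro _ ⟨x, hx, rfl⟩
      refine ⟨x.2, ?_⟩
      have : P.orthogonalProjectionOnto (x : H) = 0 := hx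
      simpa [Submodule.orthogonalProjectionOnto_eq_zero_iff] using this
    rw [← Submodule.finrank_map_subtype_eq V (LinearMap.ker f)]
    have : FiniteDimensional ℂ (V ⊓ Pᗮ : Submodule ℂ H) :=
      Submodule.finiteDimensional_of_le inf_le_left
    exact Submodule.finrank_mono h4
  omega

/-- A nonzero vector of `V ⊓ Uᗮ` would satisfy both bounds, which `δ < ε` forbids. Every min-max
estimate below reduces to this. -/
theorem finrank_le_of_norm_bounds {F : Type*} [NormedAddCommGroup F] (f : H → F) {ε δ : ℝ}
    (hδε : δ < ε) (V U : Submodule ℂ H) [FiniteDimensional ℂ V] [FiniteDimensional ℂ U]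
    (hV : ∀ v ∈ V, ε * ‖v‖ ≤ ‖f v‖) (hU : ∀ v ∈ Uᗮ, ‖f v‖ ≤ δ * ‖v‖) :
    Module.finrank ℂ V ≤ Module.finrank ℂ U := by
  have h0 : V ⊓ Uᗮ = ⊥ := by
    rw [Submodule.eq_bot_iff]
    rintro v ⟨h1, h2⟩
    by_contra hv
    have h3 := norm_pos_iff.mpr hv
    have := (hV v h1).trans (hU v h2)
    nlinarith
  have := V.finrank_le_finrank_inf_orthogonal_add U
  rw [h0, finrank_bot, zero_add] at this
  exact this

variable [CompleteSpace H]

/-- Composing `A` with the projections onto the subspaces `U` gives finite-rank operators converging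
to `A` in norm. -/
theorem isCompactOperator_of_forall_exists_finiteDimensional (A : H →L[ℂ] H)
    (h : ∀ ε : ℝ, 0 < ε → ∃ U : Submodule ℂ H, FiniteDimensional ℂ U ∧
      ∀ v ∈ Uᗮ, ‖A v‖ ≤ ε * ‖v‖) : IsCompactOperator A := by
  have hcl := isClosed_setOfPred_isCompactOperator (𝕜₁ := ℂ) (𝕜₂ := ℂ) (σ₁₂ := RingHom.id ℂ)
    (M₁ := H) (M₂ := H)
  refine hcl.closure_subset_iff.mpr subset_rfl (Metric.mem_closure_iff.mpr fun ε hε => ?_)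
  obtain ⟨U, hfin, hU⟩ := h (ε / 2) (half_pos hε)
  refine ⟨A ∘L U.starProjection, ?_, ?_⟩
  · have : IsCompactOperator (U.orthogonalProjectionOnto : H → U) :=
      isCompactOperator_of_locallyCompactSpace_dom U.orthogonalProjectionOnto
    exact this.clm_comp (A ∘L U.subtypeL)
  · rw [dist_eq_norm]
    refine lt_of_le_of_lt (ContinuousLinearMap.opNorm_le_bound _ (half_pos hε).le fun v => ?_)
      (half_lt_self hε)
    have h1 : (A - A ∘L U.starProjection) v = A (v - U.starProjection v) := by simp
    have h2 : ‖v - U.starProjection v‖ ≤ ‖v‖ := by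
      have := Uᗮ.norm_starProjection_apply_le v
      rwa [Submodule.starProjection_orthogonal_val] at this
    rw [h1]
    refine (hU _ (Submodule.sub_starProjection_mem_orthogonal v)).trans ?_
    gcongr

theorem norm_cfcAbs_apply (T : H →L[ℂ] H) (v : H) : ‖(CFC.abs T : H →L[ℂ] H) v‖ = ‖T v‖ := by
  have hA : IsSelfAdjoint (CFC.abs T) := (CFC.abs_nonneg T).isSelfAdjoint
  have h := CFC.abs_mul_abs T
  have h1 : inner ℂ (CFC.abs T v) (CFC.abs T v) = inner ℂ (T v) (T v) := by
    rw [← ContinuousLinearMap.adjoint_inner_right, ← ContinuousLinearMap.adjoint_inner_right,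
      hA.adjoint_eq]
    have := congrArg (fun f : H →L[ℂ] H => inner ℂ v (f v)) h
    simpa [ContinuousLinearMap.star_eq_adjoint] using this
  rw [inner_self_eq_norm_sq_to_K, inner_self_eq_norm_sq_to_K] at h1
  have h2 : ‖(CFC.abs T : H →L[ℂ] H) v‖ ^ 2 = ‖T v‖ ^ 2 := by exact_mod_cast h1
  exact (sq_eq_sq₀ (norm_nonneg _) (norm_nonneg _)).mp h2

/-- The span of the eigenspaces of `A` for the finitely many real eigenvalues in `F`. -/
def eigenspan (A : H →L[ℂ] H) (F : Finset ℝ) : Submodule ℂ H :=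
  ⨆ μ ∈ F, Module.End.eigenspace (A : H →ₗ[ℂ] H) (μ : ℂ)

omit [CompleteSpace H] in
theorem eigenspaces_ofReal_iSupIndep (A : H →L[ℂ] H) :
    iSupIndep fun μ : ℝ => Module.End.eigenspace (A : H →ₗ[ℂ] H) (μ : ℂ) :=
  (Module.End.eigenspaces_iSupIndep (A : H →ₗ[ℂ] H)).comp Complex.ofReal_injective

omit [CompleteSpace H] in
theorem finiteDimensional_finrank_eigenspan (A : H →L[ℂ] H) (F : Finset ℝ)
    (hF : ∀ μ ∈ F, FiniteDimensional ℂ (Module.End.eigenspace (A : H →ₗ[ℂ] H) (μ : ℂ))) :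
    FiniteDimensional ℂ (eigenspan A F) ∧ Module.finrank ℂ (eigenspan A F) =
      ∑ μ ∈ F, Module.finrank ℂ (Module.End.eigenspace (A : H →ₗ[ℂ] H) (μ : ℂ)) := by
  classical
  induction F using Finset.induction_on with
  | empty =>
    have : eigenspan A ∅ = ⊥ := by simp [eigenspan]
    rw [this]
    exact ⟨inferInstance, by simp⟩
  | insert a F ha ih =>
    obtain ⟨h1, h2⟩ := ih fun μ hμ => hF μ (Finset.mem_insert_of_mem hμ)
    have := hF a (Finset.mem_insert_self a F)
    have h3 : eigenspan A (insert a F) =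
        Module.End.eigenspace (A : H →ₗ[ℂ] H) (a : ℂ) ⊔ eigenspan A F := by
      rw [eigenspan, Finset.iSup_insert, ← eigenspan]
    have h4 : Disjoint (Module.End.eigenspace (A : H →ₗ[ℂ] H) (a : ℂ)) (eigenspan A F) := by
      have := (eigenspaces_ofReal_iSupIndep A).disjoint_biSup (x := a) (y := (F : Set ℝ))
        (by simpa using ha)
      simpa [eigenspan] using this
    rw [h3, Finset.sum_insert ha, ← h2]
    refine ⟨inferInstance, ?_⟩
    have := Submodule.finrank_sup_add_finrank_inf_eq
      (Module.End.eigenspace (A : H →ₗ[ℂ] H) (a : ℂ)) (eigenspan A F)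
    rw [h4.eq_bot, finrank_bot] at this
    exact this

omit [CompleteSpace H] in
theorem le_norm_apply_of_mem_eigenspan {A : H →L[ℂ] H} (hA : (A : H →ₗ[ℂ] H).IsSymmetric)
    {F : Finset ℝ} {ε : ℝ} (hε : 0 ≤ ε) (hF : ∀ μ ∈ F, ε ≤ μ) {v : H} (hv : v ∈ eigenspan A F) :
    ε * ‖v‖ ≤ ‖A v‖ := by
  obtain ⟨w, rfl⟩ := (Submodule.mem_iSup_finset_iff_exists_sum _ _).mp hv
  have hO := hA.orthogonalFamily_eigenspaces.comp Complex.ofReal_injective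
  have h1 : A (∑ μ ∈ F, (w μ : H)) = ∑ μ ∈ F, (((μ : ℂ) • w μ :
      Module.End.eigenspace (A : H →ₗ[ℂ] H) (μ : ℂ)) : H) := by
    rw [map_sum]
    refine Finset.sum_congr rfl fun μ _ => ?_
    exact Module.End.mem_eigenspace_iff.mp (w μ).2
  rw [h1]
  refine (sq_le_sq₀ (by positivity) (norm_nonneg _)).mp ?_
  rw [mul_pow]
  have h2 := hO.norm_sum w F
  have h3 := hO.norm_sum (fun μ => (μ : ℂ) • w μ) F
  erw [h2, h3, Finset.mul_sum]
  refine Finset.sum_le_sum fun μ hμ => ?_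
  rw [norm_smul, mul_pow]
  have := hF μ hμ
  gcongr
  rw [Complex.norm_real, Real.norm_eq_abs]
  exact this.trans (le_abs_self _)

/-- The restriction of `A` to the invariant complement is self-adjoint, so its norm is its spectral
radius, and compact, so its nonzero spectrum consists of eigenvalues. An eigenvector there with
eigenvalue above `δ` would lie in the eigenspan and be orthogonal to it. -/
theorem norm_apply_le_of_mem_orthogonal_eigenspan {A : H →L[ℂ] H} (hA : (0 : H →L[ℂ] H) ≤ A)
    (hc : IsCompactOperator A) {F : Finset ℝ} {δ : ℝ} (hδ : 0 < δ)
    (hF : ∀ μ : ℝ, δ ≤ μ → Module.End.HasEigenvalue (A : H →ₗ[ℂ] H) (μ : ℂ) → μ ∈ F)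
    {v : H} (hv : v ∈ (eigenspan A F)ᗮ) : ‖A v‖ ≤ δ * ‖v‖ := by
  have hpos := (ContinuousLinearMap.nonneg_iff_isPositive A).mp hA
  have hsym : (A : H →ₗ[ℂ] H).IsSymmetric := hpos.isSymmetric
  have hinv : ∀ w ∈ (eigenspan A F)ᗮ, (A : H →ₗ[ℂ] H) w ∈ (eigenspan A F)ᗮ := by
    intro w hw
    have h1 : eigenspan A F ≤ (ℂ ∙ A w)ᗮ := by
      refine iSup₂_le fun μ hμ x hx => Submodule.mem_orthogonal_singleton_iff_inner_left.mpr ?_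
      exact hsym.invariant_orthogonalComplement_eigenspace _ w
        (Submodule.orthogonal_le (le_iSup₂_of_le μ hμ le_rfl) hw) x hx
    exact fun x hx => Submodule.mem_orthogonal_singleton_iff_inner_left.mp (h1 hx)
  let S : (eigenspan A F)ᗮ →L[ℂ] (eigenspan A F)ᗮ := A.restrict hinv
  have hSc : IsCompactOperator S := hc.restrict' hinv
  have hSs : S.IsSymmetric := hsym.restrict_invariant hinv
  have hS : ‖S‖ ≤ δ := by
    have h1 := S.spectralRadius_eq_nnnorm hSs.isSelfAdjoint
    have h2 : spectralRadius ℂ S ≤ (δ.toNNReal : ENNReal) := by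
      refine iSup₂_le fun k hk => ENNReal.coe_le_coe.mpr ?_
      rw [← NNReal.coe_le_coe, coe_nnnorm, Real.coe_toNNReal _ hδ.le]
      by_contra! hkδ
      have hk0 : k ≠ 0 := norm_pos_iff.mp (hδ.trans hkδ)
      obtain ⟨w, hw, hw0⟩ :=
        ((hSc.hasEigenvalue_iff_mem_spectrum hk0).mpr hk).exists_hasEigenvector
      have hAw : (w : H) ∈ Module.End.eigenspace (A : H →ₗ[ℂ] H) k :=
        Module.End.mem_eigenspace_iff.mpr
          (congrArg Subtype.val (Module.End.mem_eigenspace_iff.mp hw))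
      have hw0' : (w : H) ≠ 0 := by simpa using hw0
      have hev := Module.End.hasEigenvalue_of_hasEigenvector ⟨hAw, hw0'⟩
      have hre : ((k.re : ℝ) : ℂ) = k := Complex.conj_eq_iff_re.mp (hsym.conj_eigenvalue_eq_self hev)
      have hev' : Module.End.HasEigenvalue (A : H →ₗ[ℂ] H) (k.re : ℂ) := hre.symm ▸ hev
      have hnn : 0 ≤ k.re := eigenvalue_nonneg_of_nonneg hev' hpos.re_inner_nonneg_right
      have hδk : δ ≤ k.re := by
        rw [← hre, Complex.norm_real, Real.norm_of_nonneg hnn] at hkδ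
        exact hkδ.le
      have hmem : (w : H) ∈ eigenspan A F :=
        (le_iSup₂_of_le k.re (hF _ hδk hev') (by rw [hre]) :
          Module.End.eigenspace (A : H →ₗ[ℂ] H) k ≤ eigenspan A F) hAw
      exact hw0' (inner_self_eq_zero.mp (w.2 _ hmem))
    rw [h1, ENNReal.coe_le_coe, ← NNReal.coe_le_coe, Real.coe_toNNReal _ hδ.le] at h2
    exact h2
  have := S.le_of_opNorm_le hS ⟨v, hv⟩
  exact this

theorem finiteDimensional_eigenspace_ofReal {A : H →L[ℂ] H} (hc : IsCompactOperator A) {μ : ℝ}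
    (hμ : 0 < μ) : FiniteDimensional ℂ (Module.End.eigenspace (A : H →ₗ[ℂ] H) (μ : ℂ)) :=
  A.finite_dimensional_eigenspace hc _ (by exact_mod_cast hμ.ne')

end HilbertSpace

/-! ### Decreasing enumerations of multisets of positive reals -/

section Enumeration

/-- The number of points in `[ε, ∞)`, counted with multiplicity `d`. -/
noncomputable def countGE (d : ℝ → ℕ) (ε : ℝ) : ℕ := ∑ᶠ μ ∈ {μ | ε ≤ μ}, d μ

variable {d : ℝ → ℕ}

theorem countGE_eq_sum {ε : ℝ} {F : Finset ℝ} (hF : ∀ μ, μ ∈ F ↔ ε ≤ μ ∧ d μ ≠ 0) :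
    countGE d ε = ∑ μ ∈ F, d μ := by
  rw [countGE, finsum_mem_eq_sum_of_inter_support_eq]
  ext μ
  simp [hF, Function.mem_support]

theorem countGE_eq_sum_toFinset {ε : ℝ} (hd : {μ | ε ≤ μ ∧ d μ ≠ 0}.Finite) :
    countGE d ε = ∑ μ ∈ hd.toFinset, d μ :=
  countGE_eq_sum (by simp)

theorem countGE_anti {ε δ : ℝ} (hδ : {μ | δ ≤ μ ∧ d μ ≠ 0}.Finite) (h : δ ≤ ε) :
    countGE d ε ≤ countGE d δ := by
  have hε : {μ | ε ≤ μ ∧ d μ ≠ 0}.Finite := hδ.subset fun μ hμ => ⟨h.trans hμ.1, hμ.2⟩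
  rw [countGE_eq_sum_toFinset hε, countGE_eq_sum_toFinset hδ]
  refine Finset.sum_le_sum_of_subset fun μ hμ => ?_
  simp only [Finite.mem_toFinset, mem_ofPred_eq] at hμ ⊢
  exact ⟨h.trans hμ.1, hμ.2⟩

/-- `s` is a non-increasing non-negative enumeration of the positive reals with multiplicity `d`. -/
structure IsEnumeration (d : ℝ → ℕ) (s : ℕ+ → ℝ) : Prop where
  antitone : Antitone s
  nonneg : ∀ n, 0 ≤ s n
  encard_eq : ∀ μ : ℝ, 0 < μ → {n : ℕ+ | s n = μ}.encard = d μ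

theorem PNat.encard_setOf_le (k : ℕ) : {n : ℕ+ | (n : ℕ) ≤ k}.encard = k := by
  have : {n : ℕ+ | (n : ℕ) ≤ k} = (fun i : Fin k => Nat.succPNat i) '' univ := by
    ext n
    simp only [mem_ofPred_eq, image_univ, mem_range]
    constructor
    · intro h
      have := n.pos
      exact ⟨⟨n - 1, by omega⟩, PNat.eq (by simp; omega)⟩
    · rintro ⟨i, rfl⟩
      simp
  rw [this, Function.Injective.encard_image]
  · simp
  · exact fun i j h => Fin.ext (Nat.succPNat_injective h)

/-- A lower set of positive integers with `k` elements is `{1, …, k}`. -/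
theorem IsLowerSet.mem_iff_le_of_encard_eq {S : Set ℕ+} (hS : IsLowerSet S) {k : ℕ}
    (hk : S.encard = k) (n : ℕ+) : n ∈ S ↔ (n : ℕ) ≤ k := by
  constructor
  · intro h
    have : {m : ℕ+ | (m : ℕ) ≤ (n : ℕ)} ⊆ S := fun m hm => hS (by exact_mod_cast hm) h
    have h2 := encard_le_encard this
    rw [PNat.encard_setOf_le, hk] at h2
    exact_mod_cast h2
  · intro h
    by_contra hn
    have : S ⊆ {m : ℕ+ | (m : ℕ) ≤ (n : ℕ) - 1} := by
      intro m hm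
      by_contra hmn
      refine hn (hS ?_ hm)
      rw [mem_ofPred_eq] at hmn
      have : (n : ℕ) ≤ m := by omega
      exact_mod_cast this
    have h2 := encard_le_encard this
    rw [PNat.encard_setOf_le, hk] at h2
    have h3 : k ≤ (n : ℕ) - 1 := by exact_mod_cast h2
    have := n.pos
    omega

theorem encard_biUnion_finset_eq_sum {ι : Type*} (s : ι → ℝ) (F : Finset ℝ) :
    {n | s n ∈ F}.encard = ∑ μ ∈ F, {n | s n = μ}.encard := by
  classical
  induction F using Finset.induction_on with
  | empty => simp
  | insert a F ha ih =>
    rw [Finset.sum_insert ha, ← ih, ← encard_union_eq]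
    · congr 1
      ext n
      simp
    · rw [Set.disjoint_left]
      intro n h1 h2
      rw [mem_ofPred_eq] at h1 h2
      exact ha (h1 ▸ h2)

/-- By monotonicity the indices with `ε ≤ s n` form an initial segment, and summing fibres gives its
length. The sequence is thus determined by the counting function. -/
theorem IsEnumeration.le_iff {s : ℕ+ → ℝ} (hs : IsEnumeration d s) {ε : ℝ} (hε : 0 < ε)
    (hd : {μ | ε ≤ μ ∧ d μ ≠ 0}.Finite) (n : ℕ+) : ε ≤ s n ↔ (n : ℕ) ≤ countGE d ε := by
  have h1 : {n : ℕ+ | ε ≤ s n} = {n | s n ∈ hd.toFinset} := by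
    ext n
    simp only [mem_ofPred_eq, Finite.mem_toFinset]
    refine ⟨fun h => ⟨h, fun h0 => ?_⟩, fun h => h.1⟩
    have := hs.encard_eq (s n) (hε.trans_le h)
    rw [h0, Nat.cast_zero, encard_eq_zero] at this
    exact (this ▸ (rfl : s n = s n) : n ∈ (∅ : Set ℕ+))
  have h2 : {n : ℕ+ | ε ≤ s n}.encard = countGE d ε := by
    rw [h1, encard_biUnion_finset_eq_sum, countGE_eq_sum_toFinset hd, Nat.cast_sum]
    refine Finset.sum_congr rfl fun μ hμ => hs.encard_eq μ (hε.trans_le ?_)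
    simp only [Finite.mem_toFinset, mem_ofPred_eq] at hμ
    exact hμ.1
  have h3 : IsLowerSet {n : ℕ+ | ε ≤ s n} := fun a b hba ha => le_trans ha (hs.antitone hba)
  exact h3.mem_iff_le_of_encard_eq h2 n

theorem IsEnumeration.unique (hd : ∀ ε : ℝ, 0 < ε → {μ | ε ≤ μ ∧ d μ ≠ 0}.Finite)
    {s s' : ℕ+ → ℝ} (hs : IsEnumeration d s) (hs' : IsEnumeration d s') : s = s' := by
  have key : ∀ {s s' : ℕ+ → ℝ}, IsEnumeration d s → IsEnumeration d s' → ∀ n, s n ≤ s' n := by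
    intro s s' hs hs' n
    rcases (hs.nonneg n).eq_or_lt with h | h
    · rw [← h]; exact hs'.nonneg n
    · rw [hs'.le_iff h (hd _ h), ← hs.le_iff h (hd _ h)]
  exact funext fun n => le_antisymm (key hs hs' n) (key hs' hs n)

/-- The smallest point at or above `ε` with nonzero multiplicity has the same count. -/
theorem exists_countGE_eq {ε : ℝ} (hd : {μ | ε ≤ μ ∧ d μ ≠ 0}.Finite) (h : countGE d ε ≠ 0) :
    ∃ ν, ε ≤ ν ∧ d ν ≠ 0 ∧ countGE d ν = countGE d ε := by
  have hne : hd.toFinset.Nonempty := by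
    rw [Finset.nonempty_iff_ne_empty]
    intro h0
    rw [countGE_eq_sum_toFinset hd, h0] at h
    simp at h
  obtain ⟨ν, hν, hmin⟩ := hd.toFinset.exists_min_image id hne
  simp only [Finite.mem_toFinset, mem_ofPred_eq, id] at hν hmin
  refine ⟨ν, hν.1, hν.2, ?_⟩
  rw [countGE_eq_sum_toFinset hd, countGE_eq_sum (ε := ν) (F := hd.toFinset)]
  intro μ
  simp only [Finite.mem_toFinset, mem_ofPred_eq]
  exact ⟨fun h => ⟨hmin μ h, h.2⟩, fun h => ⟨hν.1.trans h.1, h.2⟩⟩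

theorem exists_isEnumeration (hd : ∀ ε : ℝ, 0 < ε → {μ | ε ≤ μ ∧ d μ ≠ 0}.Finite) :
    ∃ s, IsEnumeration d s := by
  -- The `n`-th term is the largest `x` with at least `n` points in `[x, ∞)`, or `0` if there is
  -- none. The count jumps only at points of nonzero multiplicity, so the maximum runs over a finite
  -- set.
  have hex : ∀ n : ℕ+, ∃ x : ℝ, 0 ≤ x ∧ ∀ μ : ℝ, 0 < μ → (μ ≤ x ↔ (n : ℕ) ≤ countGE d μ) := by
    intro n
    by_cases h : ∃ μ : ℝ, 0 < μ ∧ (n : ℕ) ≤ countGE d μ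
    · obtain ⟨μ, hμ, hn⟩ := h
      let F := (hd μ hμ).toFinset.filter fun ν => (n : ℕ) ≤ countGE d ν
      have hF : ∀ ν, ν ∈ F ↔ (μ ≤ ν ∧ d ν ≠ 0) ∧ (n : ℕ) ≤ countGE d ν := by simp [F]
      have lift : ∀ ν : ℝ, μ ≤ ν → (n : ℕ) ≤ countGE d ν → ∃ ξ ∈ F, ν ≤ ξ := by
        intro ν hν hnν
        obtain ⟨ξ, h1, h2, h3⟩ := exists_countGE_eq (hd ν (hμ.trans_le hν))
          (by have := n.pos; omega)
        exact ⟨ξ, (hF ξ).2 ⟨⟨hν.trans h1, h2⟩, h3 ▸ hnν⟩, h1⟩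
      obtain ⟨ξ, hξ, -⟩ := lift μ le_rfl hn
      obtain ⟨x, hx, hmax⟩ := F.exists_max_image id ⟨ξ, hξ⟩
      rw [hF] at hx
      have hx0 : 0 < x := hμ.trans_le hx.1.1
      refine ⟨x, hx0.le, fun ν hν => ⟨fun h => hx.2.trans (countGE_anti (hd ν hν) h), fun h => ?_⟩⟩
      rcases le_total ν μ with h' | h'
      · exact h'.trans hx.1.1
      · obtain ⟨ζ, hζ, h1⟩ := lift ν h' h
        exact h1.trans (hmax ζ hζ)
    · push Not at h
      exact ⟨0, le_rfl, fun μ hμ => ⟨fun h' => absurd h' hμ.not_ge,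
        fun h' => absurd h' (h μ hμ).not_ge⟩⟩
  choose s hs0 hs using hex
  refine ⟨s, ?_, hs0, ?_⟩
  · intro a b hab
    rcases (hs0 b).eq_or_lt with h | h
    · rw [← h]; exact hs0 a
    · rw [hs a _ h]
      have h1 := (hs b _ h).1 le_rfl
      have : (a : ℕ) ≤ b := by exact_mod_cast hab
      omega
  · intro μ hμ
    have hfin := hd μ hμ
    -- the number of points strictly above `μ`
    obtain ⟨k, hk, hlt⟩ : ∃ k, countGE d μ = d μ + k ∧ ∀ n : ℕ+, μ < s n ↔ (n : ℕ) ≤ k := by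
      classical
      have hG : ∀ ν, ν ∈ hfin.toFinset.erase μ ↔ μ < ν ∧ d ν ≠ 0 := by
        intro ν
        simp only [Finset.mem_erase, Finite.mem_toFinset, mem_ofPred_eq]
        exact ⟨fun h => ⟨lt_of_le_of_ne h.2.1 h.1.symm, h.2.2⟩, fun h => ⟨h.1.ne', h.1.le, h.2⟩⟩
      refine ⟨∑ ν ∈ hfin.toFinset.erase μ, d ν, ?_, fun n => ?_⟩
      · rw [countGE_eq_sum_toFinset hfin]
        by_cases h0 : d μ = 0
        · rw [h0, zero_add, Finset.erase_eq_of_notMem]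
          simp [h0]
        · rw [Finset.add_sum_erase]
          simp [h0]
      · constructor
        · intro h
          refine ((hs n _ (hμ.trans h)).1 le_rfl).trans ?_
          have hfin' := hd _ (hμ.trans h)
          rw [countGE_eq_sum_toFinset hfin']
          refine Finset.sum_le_sum_of_subset fun ν hν => ?_
          rw [hG]
          simp only [Finite.mem_toFinset, mem_ofPred_eq] at hν
          exact ⟨h.trans_le hν.1, hν.2⟩
        · intro h
          have hne : (hfin.toFinset.erase μ).Nonempty := by
            rw [Finset.nonempty_iff_ne_empty]
            intro h0
            rw [h0, Finset.sum_empty] at h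
            have := n.pos
            omega
          obtain ⟨ν, hν, hmin⟩ := Finset.exists_min_image _ id hne
          rw [hG] at hν
          refine hν.1.trans_le ((hs n ν (hμ.trans hν.1)).2 ?_)
          rwa [countGE_eq_sum (F := hfin.toFinset.erase μ)]
          intro ξ
          refine ⟨fun h => ⟨hmin ξ h, ((hG ξ).1 h).2⟩, fun h => (hG ξ).2 ⟨hν.1.trans_le h.1, h.2⟩⟩
    -- The fibre over `μ` is the difference of two initial segments, of lengths `d μ + k` and `k`.
    have h1 : {n : ℕ+ | (n : ℕ) ≤ countGE d μ} = {n : ℕ+ | s n = μ} ∪ {n : ℕ+ | (n : ℕ) ≤ k} := by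
      ext n
      simp only [mem_ofPred_eq, mem_union]
      rw [← hs n μ hμ, ← hlt, le_iff_lt_or_eq, or_comm, eq_comm]
    have h2 : Disjoint {n : ℕ+ | s n = μ} {n : ℕ+ | (n : ℕ) ≤ k} := by
      rw [Set.disjoint_left]
      intro n h3 h4
      exact ((hlt n).2 h4).ne' h3
    have h3 := encard_union_eq h2
    rw [← h1, PNat.encard_setOf_le, PNat.encard_setOf_le, hk, Nat.cast_add] at h3
    exact (WithTop.add_right_cancel (ENat.natCast_ne_top k) h3).symm

end Enumeration

/-! ### Min-max bounds for singular values -/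

section MinMax

variable {H : Type*} [NormedAddCommGroup H] [InnerProductSpace ℂ H] [CompleteSpace H]

/-- Every `ε > 0` bounds `T` on the orthogonal complement of a finite-dimensional subspace. -/
def IsApproxFinite (T : H →L[ℂ] H) : Prop :=
  ∀ ε : ℝ, 0 < ε → ∃ U : Submodule ℂ H, FiniteDimensional ℂ U ∧ ∀ v ∈ Uᗮ, ‖T v‖ ≤ ε * ‖v‖

/-- The multiplicity of `μ` as a singular value of `T`. -/
noncomputable def singularMultiplicity (T : H →L[ℂ] H) (μ : ℝ) : ℕ :=
  Module.finrank ℂ (Module.End.eigenspace ((CFC.abs T : H →L[ℂ] H) : H →ₗ[ℂ] H) (μ : ℂ))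

namespace IsApproxFinite

variable {T : H →L[ℂ] H}

theorem isCompactOperator (hT : IsApproxFinite T) : IsCompactOperator T :=
  isCompactOperator_of_forall_exists_finiteDimensional T hT

theorem isCompactOperator_abs (hT : IsApproxFinite T) :
    IsCompactOperator (CFC.abs T : H →L[ℂ] H) :=
  isCompactOperator_of_forall_exists_finiteDimensional _ (by simpa only [norm_cfcAbs_apply])

theorem eigenspan_abs (hT : IsApproxFinite T) {F : Finset ℝ} {ε : ℝ} (hε : 0 < ε)
    (hF : ∀ μ ∈ F, ε ≤ μ) :
    FiniteDimensional ℂ (eigenspan (CFC.abs T) F) ∧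
      Module.finrank ℂ (eigenspan (CFC.abs T) F) = ∑ μ ∈ F, singularMultiplicity T μ ∧
      ∀ v ∈ eigenspan (CFC.abs T) F, ε * ‖v‖ ≤ ‖T v‖ := by
  obtain ⟨h1, h2⟩ := finiteDimensional_finrank_eigenspan (CFC.abs T) F fun μ hμ =>
    finiteDimensional_eigenspace_ofReal hT.isCompactOperator_abs (hε.trans_le (hF μ hμ))
  refine ⟨h1, h2, fun v hv => ?_⟩
  rw [← norm_cfcAbs_apply]
  exact le_norm_apply_of_mem_eigenspan
    (((ContinuousLinearMap.nonneg_iff_isPositive _).mp (CFC.abs_nonneg T)).isSymmetric) hε.le hF hv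

/-- More than `finrank U` distinct singular values above `ε` would span too large a space on which
`T` is bounded below by `ε`, where `U` controls `T` at level `ε / 2`. -/
theorem finite_support (hT : IsApproxFinite T) {ε : ℝ} (hε : 0 < ε) :
    {μ | ε ≤ μ ∧ singularMultiplicity T μ ≠ 0}.Finite := by
  obtain ⟨U, hfin, hU⟩ := hT (ε / 2) (half_pos hε)
  by_contra hinf
  obtain ⟨F, hF, hcard⟩ := Set.Infinite.exists_subset_card_eq hinf (Module.finrank ℂ U + 1)
  obtain ⟨h1, h2, h3⟩ := hT.eigenspan_abs hε fun μ hμ => (hF hμ).1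
  have h4 := finrank_le_of_norm_bounds T (half_lt_self hε) _ U h3 hU
  have h5 : F.card ≤ ∑ μ ∈ F, singularMultiplicity T μ := by
    rw [Finset.card_eq_sum_ones]
    exact Finset.sum_le_sum fun μ hμ => Nat.one_le_iff_ne_zero.mpr (hF hμ).2
  omega

/-- Compactness makes the eigenspaces for `μ > 0` finite-dimensional, so `finrank` does not take its
default value `0` there. -/
theorem isSingularValueSequence_iff (hT : IsApproxFinite T) (s : ℕ+ → ℝ) :
    IsSingularValueSequence T s ↔ IsEnumeration (singularMultiplicity T) s := by
  have h : ∀ μ : ℝ, 0 < μ → Cardinal.toENat (Module.rank ℂ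
      (Module.End.eigenspace ((CFC.abs T : H →L[ℂ] H) : H →ₗ[ℂ] H) (μ : ℂ))) =
        singularMultiplicity T μ := by
    intro μ hμ
    have := finiteDimensional_eigenspace_ofReal hT.isCompactOperator_abs hμ
    rw [singularMultiplicity, ← Module.finrank_eq_rank, Cardinal.toENat_nat]
  exact ⟨fun hs => ⟨hs.antitone, hs.nonneg, fun μ hμ => (hs.encard_eq μ hμ).trans (h μ hμ)⟩,
    fun hs => ⟨hs.antitone, hs.nonneg, fun μ hμ => (hs.encard_eq μ hμ).trans (h μ hμ).symm⟩⟩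

theorem existsUnique_isSingularValueSequence (hT : IsApproxFinite T) :
    ∃! s : ℕ+ → ℝ, IsSingularValueSequence T s := by
  simp only [hT.isSingularValueSequence_iff]
  obtain ⟨s, hs⟩ := exists_isEnumeration fun ε hε => hT.finite_support hε
  exact ⟨s, hs, fun s' hs' => hs'.unique (fun ε hε => hT.finite_support hε) hs⟩

variable {s : ℕ+ → ℝ}

/-- If `s n > ε`, the eigenvectors of `|T|` with eigenvalue at least `s n` span at least `n`
dimensions, more than `U` allows. -/
theorem singularValue_le (hT : IsApproxFinite T) (hs : IsSingularValueSequence T s)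
    (U : Submodule ℂ H) [FiniteDimensional ℂ U] {ε : ℝ} (hε : 0 ≤ ε)
    (hU : ∀ v ∈ Uᗮ, ‖T v‖ ≤ ε * ‖v‖) {n : ℕ+} (hn : Module.finrank ℂ U < n) : s n ≤ ε := by
  by_contra! h
  have hpos := hε.trans_lt h
  have hd := hT.finite_support hpos
  have h1 := (((hT.isSingularValueSequence_iff s).mp hs).le_iff hpos hd n).mp le_rfl
  rw [countGE_eq_sum_toFinset hd] at h1
  obtain ⟨h2, h3, h4⟩ := hT.eigenspan_abs (F := hd.toFinset) hpos fun μ hμ =>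
    ((Finite.mem_toFinset hd).mp hμ).1
  have h5 := finrank_le_of_norm_bounds T h _ U h4 hU
  omega

theorem le_singularValue (hT : IsApproxFinite T) (hs : IsSingularValueSequence T s)
    (V : Submodule ℂ H) [FiniteDimensional ℂ V] {ε : ℝ}
    (hV : ∀ v ∈ V, ε * ‖v‖ ≤ ‖T v‖) {n : ℕ+} (hn : n ≤ Module.finrank ℂ V) : ε ≤ s n := by
  by_contra! h
  -- The comparison of dimensions needs a strict gap below `ε`, and finiteness of the spectrum above
  -- `δ` needs `δ > 0`.
  obtain ⟨δ, hsδ, hδε⟩ := exists_between h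
  have hδ : 0 < δ := (hs.nonneg n).trans_lt hsδ
  have hd := hT.finite_support hδ
  have hmem : ∀ μ, μ ∈ hd.toFinset ↔ δ ≤ μ ∧ singularMultiplicity T μ ≠ 0 := by simp
  obtain ⟨h2, h3, -⟩ := hT.eigenspan_abs (F := hd.toFinset) hδ fun μ hμ => ((hmem μ).mp hμ).1
  have h4 : ∀ v ∈ (eigenspan (CFC.abs T) hd.toFinset)ᗮ, ‖T v‖ ≤ δ * ‖v‖ := by
    intro v hv
    rw [← norm_cfcAbs_apply]
    refine norm_apply_le_of_mem_orthogonal_eigenspan (CFC.abs_nonneg T) hT.isCompactOperator_abs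
      hδ (fun μ hμ hev => (hmem μ).mpr ⟨hμ, ?_⟩) hv
    have := finiteDimensional_eigenspace_ofReal hT.isCompactOperator_abs (hδ.trans_le hμ)
    rw [singularMultiplicity, Ne, Submodule.finrank_eq_zero]
    exact hev
  have h5 := finrank_le_of_norm_bounds T hδε V _ hV h4
  rw [h3, ← countGE_eq_sum hmem] at h5
  have := (((hT.isSingularValueSequence_iff s).mp hs).le_iff hδ hd n).mpr (hn.trans h5)
  exact absurd this hsδ.not_ge

end IsApproxFinite

end MinMax

/-! ### Fourier coefficients on `(0, t₀]` -/

section Fourier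

open scoped ComplexConjugate

/-- The exponential of frequency `n` on the interval `(0, t₀]`. -/
noncomputable def wave (t₀ : ℝ) (n : ℤ) : C(ℝ, ℂ) :=
  ⟨fun x => Complex.exp (2 * Real.pi * Complex.I * n / t₀ * x), by fun_prop⟩

/-- The monomial of degree `j`. -/
noncomputable def monomialMap (j : ℕ) : C(ℝ, ℂ) := ⟨fun x => (x : ℂ) ^ j, by fun_prop⟩

theorem conj_wave (t₀ : ℝ) (n : ℤ) (x : ℝ) : conj (wave t₀ n x) = wave t₀ (-n) x := by
  simp only [wave, ContinuousMap.coe_mk, ← Complex.exp_conj]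
  congr 1
  simp [map_ofNat (starRingEnd ℂ) 2]

theorem wave_mul_wave (t₀ : ℝ) (n k : ℤ) (x : ℝ) :
    wave t₀ n x * wave t₀ k x = wave t₀ (n + k) x := by
  simp only [wave, ContinuousMap.coe_mk, ← Complex.exp_add]
  congr 1
  push_cast
  ring

theorem restrict_Ioi_restrict_Ioc (t₀ : ℝ) :
    (volume.restrict (Ioi (0 : ℝ))).restrict (Ioc 0 t₀) = volume.restrict (Ioc 0 t₀) := by
  rw [Measure.restrict_restrict measurableSet_Ioc, inter_eq_left.mpr Ioc_subset_Ioi_self]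

theorem memLp_cutoff (t₀ : ℝ) (g : C(ℝ, ℂ)) :
    MemLp ((Ioc 0 t₀).indicator g) 2 (volume.restrict (Ioi (0 : ℝ))) := by
  rw [memLp_indicator_iff_restrict measurableSet_Ioc, restrict_Ioi_restrict_Ioc]
  obtain ⟨C, hC⟩ := isCompact_Icc.exists_bound_of_continuousOn (s := Icc 0 t₀) g.continuous.continuousOn
  refine MemLp.of_bound g.continuous.aestronglyMeasurable C ?_
  filter_upwards [ae_restrict_mem measurableSet_Ioc] with x hx using hC x (Ioc_subset_Icc_self hx)

/-- The continuous function `g`, cut off outside `(0, t₀]`, as an element of `L²(ℝ₊)`. -/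
noncomputable def cutoff (t₀ : ℝ) (g : C(ℝ, ℂ)) : L2HalfLine := (memLp_cutoff t₀ g).toLp

theorem coeFn_cutoff (t₀ : ℝ) (g : C(ℝ, ℂ)) :
    cutoff t₀ g =ᵐ[volume.restrict (Ioi (0 : ℝ))] (Ioc 0 t₀).indicator g :=
  MemLp.coeFn_toLp _

theorem inner_cutoff (t₀ : ℝ) (g : C(ℝ, ℂ)) (v : L2HalfLine) :
    inner ℂ (cutoff t₀ g) v = ∫ x in Ioc 0 t₀, conj (g x) * v x := by
  rw [L2.inner_def, ← restrict_Ioi_restrict_Ioc, ← integral_indicator measurableSet_Ioc]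
  refine integral_congr_ae ?_
  filter_upwards [coeFn_cutoff t₀ g] with x hx
  rw [hx, RCLike.inner_apply']
  by_cases h : x ∈ Ioc 0 t₀ <;> simp [h]

/-- The unnormalised Fourier coefficients of `v` on the interval `(0, t₀]`. -/
noncomputable def fourierInt (t₀ : ℝ) (v : ℝ → ℂ) (n : ℤ) : ℂ :=
  ∫ x in Ioc 0 t₀, wave t₀ (-n) x * v x

theorem inner_cutoff_wave (t₀ : ℝ) (n : ℤ) (v : L2HalfLine) :
    inner ℂ (cutoff t₀ (wave t₀ n)) v = fourierInt t₀ v n := by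
  simp only [inner_cutoff, conj_wave, fourierInt]

theorem memLp_Ioc (t₀ : ℝ) (v : L2HalfLine) : MemLp v 2 (volume.restrict (Ioc 0 t₀)) :=
  (Lp.memLp v).mono_measure (Measure.restrict_mono Ioc_subset_Ioi_self le_rfl)

theorem integrableOn_Ioc (t₀ : ℝ) (v : L2HalfLine) : IntegrableOn v (Ioc 0 t₀) :=
  (memLp_Ioc t₀ v).integrable one_le_two

/-- Parseval: these coefficients are `t₀` times the normalised ones, so the factor `t₀⁻¹` of the
mean square becomes `t₀`. -/
theorem hasSum_sq_fourierInt {t₀ : ℝ} (ht₀ : 0 < t₀) (v : L2HalfLine) :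
    HasSum (fun n => ‖fourierInt t₀ v n‖ ^ 2) (t₀ * ∫ x in Ioc 0 t₀, ‖v x‖ ^ 2) := by
  have h := (hasSum_sq_fourierCoeffOn ht₀ (memLp_Ioc t₀ v)).mul_left (t₀ ^ 2)
  have h1 : ∀ n, t₀ ^ 2 * ‖fourierCoeffOn ht₀ v n‖ ^ 2 = ‖fourierInt t₀ v n‖ ^ 2 := by
    intro n
    rw [fourierCoeffOn_eq_integral, intervalIntegral.integral_of_le ht₀.le, norm_smul, mul_pow,
      ← mul_assoc]
    have : t₀ ^ 2 * ‖1 / (t₀ - 0)‖ ^ 2 = 1 := by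
      rw [Real.norm_of_nonneg (by simpa using ht₀.le)]
      have := ht₀.ne'
      rw [sub_zero]
      field_simp
    rw [this, one_mul, fourierInt]
    congr 3
    funext x
    simp only [fourier_coe_apply, wave, ContinuousMap.coe_mk, smul_eq_mul]
    congr 2
    simp
    ring
  simp only [h1] at h
  rwa [intervalIntegral.integral_of_le ht₀.le, smul_eq_mul, sub_zero, ← mul_assoc, pow_two,
    mul_inv_cancel_right₀ ht₀.ne'] at h

theorem norm_sq_eq_integral (v : L2HalfLine) : ‖v‖ ^ 2 = ∫ x in Ioi (0 : ℝ), ‖v x‖ ^ 2 := by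
  have h := congrArg RCLike.re (L2.inner_def (𝕜 := ℂ) v v)
  rw [← integral_re (L2.integrable_inner v v)] at h
  simpa only [← norm_sq_eq_re_inner] using h

theorem integrableOn_norm_sq (v : L2HalfLine) : IntegrableOn (fun x => ‖v x‖ ^ 2) (Ioi (0 : ℝ)) :=
  (memLp_two_iff_integrable_sq_norm (Lp.aestronglyMeasurable v)).mp (Lp.memLp v)

theorem integral_Ioc_norm_sq_le (t₀ : ℝ) (v : L2HalfLine) :
    ∫ x in Ioc 0 t₀, ‖v x‖ ^ 2 ≤ ‖v‖ ^ 2 := by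
  rw [norm_sq_eq_integral]
  exact setIntegral_mono_set (integrableOn_norm_sq v) (ae_of_all _ fun x => by positivity)
    Ioc_subset_Ioi_self.eventuallyLE

theorem integral_Ioc_norm_sq_eq {t₀ : ℝ} {v : L2HalfLine}
    (hv : ∀ᵐ x ∂volume.restrict (Ioi (0 : ℝ)), t₀ < x → v x = 0) :
    ∫ x in Ioc 0 t₀, ‖v x‖ ^ 2 = ‖v‖ ^ 2 := by
  rw [norm_sq_eq_integral]
  symm
  refine setIntegral_eq_of_subset_of_ae_sdiff_eq_zero measurableSet_Ioi.nullMeasurableSet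
    Ioc_subset_Ioi_self ?_
  rw [ae_restrict_iff' measurableSet_Ioi] at hv
  filter_upwards [hv] with x hx hmem
  rw [hx hmem.1 (by_contra fun h => hmem.2 ⟨hmem.1, not_lt.mp h⟩)]
  simp

theorem fourierInt_wave {t₀ : ℝ} (ht₀ : 0 < t₀) (n k : ℤ) :
    fourierInt t₀ (wave t₀ k) n = if n = k then (t₀ : ℂ) else 0 := by
  simp only [fourierInt, wave_mul_wave]
  split_ifs with h
  · subst h
    simp [wave, ht₀.le]
  · rw [← intervalIntegral.integral_of_le ht₀.le]
    have h0 : (2 * Real.pi * Complex.I * ((-n + k : ℤ) : ℂ) / t₀) ≠ 0 := by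
      have h1 : ((-n + k : ℤ) : ℂ) ≠ 0 := by exact_mod_cast fun h' => h (by omega)
      have h2 : (t₀ : ℂ) ≠ 0 := by exact_mod_cast ht₀.ne'
      have h3 : (Real.pi : ℂ) ≠ 0 := by exact_mod_cast Real.pi_ne_zero
      simp only [ne_eq, div_eq_zero_iff, mul_eq_zero, not_or]
      exact ⟨⟨⟨⟨two_ne_zero, h3⟩, Complex.I_ne_zero⟩, h1⟩, h2⟩
    simp only [wave, ContinuousMap.coe_mk]
    rw [integral_exp_mul_complex h0]
    have h2 : (t₀ : ℂ) ≠ 0 := by exact_mod_cast ht₀.ne'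
    have h4 : 2 * Real.pi * Complex.I * ((-n + k : ℤ) : ℂ) / t₀ * t₀ =
        ((-n + k : ℤ) : ℂ) * (2 * Real.pi * Complex.I) := by
      field_simp
    rw [h4, Complex.exp_int_mul_two_pi_mul_I]
    simp

theorem fourierInt_congr {t₀ : ℝ} {v w : ℝ → ℂ} (h : v =ᵐ[volume.restrict (Ioc 0 t₀)] w) (n : ℤ) :
    fourierInt t₀ v n = fourierInt t₀ w n :=
  integral_congr_ae (h.mono fun x hx => by simp only [hx])

theorem coeFn_cutoff_Ioc (t₀ : ℝ) (g : C(ℝ, ℂ)) :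
    cutoff t₀ g =ᵐ[volume.restrict (Ioc 0 t₀)] g := by
  have h := ae_restrict_of_ae (s := Ioc 0 t₀) (coeFn_cutoff t₀ g)
  rw [restrict_Ioi_restrict_Ioc] at h
  filter_upwards [h, ae_restrict_mem measurableSet_Ioc] with x hx hm
  rw [hx, indicator_of_mem hm]

theorem inner_cutoff_wave_wave {t₀ : ℝ} (ht₀ : 0 < t₀) (n k : ℤ) :
    inner ℂ (cutoff t₀ (wave t₀ n)) (cutoff t₀ (wave t₀ k)) = if n = k then (t₀ : ℂ) else 0 := by
  rw [inner_cutoff_wave, fourierInt_congr (coeFn_cutoff_Ioc _ _), fourierInt_wave ht₀]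

end Fourier

/-! ### Convolution of an exponential with a power -/

section IteratedIntegral

/-- The convolution of an exponential with a power is, modulo polynomials, an exponential. -/
theorem exists_polynomial_integral_exp_mul_pow (m : ℕ) (c : ℂ) :
    ∃ P : Polynomial ℂ, P.natDegree ≤ m + 1 ∧ ∀ y : ℝ,
      ∫ t in (0 : ℝ)..y, Complex.exp (c * t) * ((y - t : ℝ) : ℂ) ^ m =
        P.eval (y : ℂ) + m.factorial / c ^ (m + 1) * Complex.exp (c * y) := by
  -- Here `m! / c^(m+1)` is `0` by convention and the integral is itself a polynomial, of degree
  -- exactly `m + 1`; this case dictates the degree bound.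
  by_cases hc : c = 0
  · refine ⟨Polynomial.C (1 / (m + 1 : ℂ)) * Polynomial.X ^ (m + 1),
      Polynomial.natDegree_C_mul_X_pow_le _ _, fun y => ?_⟩
    have h : ∫ t in (0 : ℝ)..y, ((y - t) ^ m : ℝ) = y ^ (m + 1) / (m + 1) := by
      rw [intervalIntegral.integral_comp_sub_left (fun t => t ^ m), integral_pow]
      simp
    subst hc
    have h' := congrArg ((↑) : ℝ → ℂ) h
    rw [← intervalIntegral.integral_ofReal] at h'
    push_cast at h' ⊢
    simp [h']
    ring
  · induction m with
    | zero =>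
      refine ⟨Polynomial.C (-1 / c), by simp, fun y => ?_⟩
      simp only [pow_zero, mul_one]
      rw [integral_exp_mul_complex hc]
      simp
      ring
    | succ m ih =>
      obtain ⟨P, hP, h⟩ := ih
      refine ⟨Polynomial.C ((m + 1 : ℂ) / c) * P - Polynomial.C (1 / c) * Polynomial.X ^ (m + 1),
        ?_, fun y => ?_⟩
      · refine (Polynomial.natDegree_sub_le _ _).trans (max_le ?_ ?_)
        · exact (Polynomial.natDegree_C_mul_le _ _).trans (by omega)
        · exact (Polynomial.natDegree_C_mul_X_pow_le _ _).trans (by omega)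
      -- The boundary term vanishes at `t = y` and contributes `-y^(m+1) / c` at `t = 0`.
      · have hparts := intervalIntegral.integral_mul_deriv_eq_deriv_mul (a := 0) (b := y)
          (u := fun t : ℝ => ((y - t : ℝ) : ℂ) ^ (m + 1)) (v := fun t : ℝ => Complex.exp (c * t) / c)
          (u' := fun t : ℝ => -((m + 1 : ℂ) * ((y - t : ℝ) : ℂ) ^ m))
          (v' := fun t : ℝ => Complex.exp (c * t)) ?_ ?_ ?_ ?_
        · have e1 : ∫ t in (0 : ℝ)..y, Complex.exp (c * t) * ((y - t : ℝ) : ℂ) ^ (m + 1) =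
              ∫ t in (0 : ℝ)..y, ((y - t : ℝ) : ℂ) ^ (m + 1) * Complex.exp (c * t) := by
            simp only [mul_comm]
          have e2 : ∫ t in (0 : ℝ)..y, -((m + 1 : ℂ) * ((y - t : ℝ) : ℂ) ^ m) *
              (Complex.exp (c * t) / c) = -((m + 1) / c) *
              ∫ t in (0 : ℝ)..y, Complex.exp (c * t) * ((y - t : ℝ) : ℂ) ^ m := by
            rw [← intervalIntegral.integral_const_mul]
            refine intervalIntegral.integral_congr fun t _ => ?_
            ring
          rw [e1, hparts, e2, h]
          simp [Nat.factorial_succ]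
          field_simp
          ring
        · intro t _
          have h1 : HasDerivAt (fun t : ℝ => ((y - t : ℝ) : ℂ)) (-1) t := by
            have := ((hasDerivAt_id t).const_sub y).ofReal_comp
            simpa using this
          have := h1.pow (m + 1)
          refine this.congr_deriv ?_
          push_cast
          simp
        · intro t _
          have h1 : HasDerivAt (fun t : ℝ => c * (t : ℂ)) c t := by
            simpa using (Complex.ofRealCLM.hasDerivAt (x := t)).const_mul c
          have := h1.cexp.div_const c
          convert this using 1
          field_simp
        · exact Continuous.intervalIntegrable (by fun_prop) _ _
        · exact Continuous.intervalIntegrable (by fun_prop) _ _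

end IteratedIntegral

/-! ### Construction and uniqueness of the Hankel operator -/

section Hankel

open scoped ComplexConjugate

variable (m : ℕ) (t₀ : ℝ)

theorem truncatedPower_of_lt {t : ℝ} (h : t < t₀) :
    truncatedPower m t₀ t = ((t₀ - t : ℝ) : ℂ) ^ m := by
  have : t₀ - t ∈ Ioi (0 : ℝ) := sub_pos.mpr h
  rw [truncatedPower, indicator_of_mem this, mul_one, Complex.ofReal_pow]

theorem truncatedPower_of_le {t : ℝ} (h : t₀ ≤ t) : truncatedPower m t₀ t = 0 := by
  have : t₀ - t ∉ Ioi (0 : ℝ) := by simpa using h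
  rw [truncatedPower, indicator_of_notMem this, mul_zero, Complex.ofReal_zero]

theorem conj_truncatedPower (t : ℝ) : conj (truncatedPower m t₀ t) = truncatedPower m t₀ t :=
  Complex.conj_ofReal _

theorem measurable_truncatedPower : Measurable (truncatedPower m t₀) := by
  unfold truncatedPower
  have h : Measurable ((Ioi (0 : ℝ)).indicator fun _ => (1 : ℝ)) :=
    measurable_const.indicator measurableSet_Ioi
  have h2 : Measurable fun t : ℝ => t₀ - t := by fun_prop
  exact Complex.measurable_ofReal.comp ((h2.pow_const m).mul (h.comp h2))

variable {m t₀}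

theorem norm_truncatedPower_le {t : ℝ} (ht₀ : 0 < t₀) (ht : 0 ≤ t) :
    ‖truncatedPower m t₀ t‖ ≤ t₀ ^ m := by
  rcases lt_or_ge t t₀ with h | h
  · rw [truncatedPower_of_lt m t₀ h, norm_pow, Complex.norm_real, Real.norm_of_nonneg (by linarith)]
    exact pow_le_pow_left₀ (by linarith) (by linarith) m
  · rw [truncatedPower_of_le m t₀ h, norm_zero]
    positivity

theorem norm_truncatedPower_add_le {t s : ℝ} (ht₀ : 0 < t₀) (ht : 0 < t) (hs : 0 < s) :
    ‖truncatedPower m t₀ (t + s)‖ ≤ t₀ ^ m * ‖(Ioc 0 t₀).indicator (1 : C(ℝ, ℂ)) s‖ := by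
  by_cases h : s ≤ t₀
  · rw [indicator_of_mem (show s ∈ Ioc 0 t₀ from ⟨hs, h⟩)]
    simpa using norm_truncatedPower_le ht₀ (add_pos ht hs).le
  · rw [truncatedPower_of_le m t₀ (by linarith), norm_zero]
    positivity

theorem memLp_truncatedPower_add {t : ℝ} (ht₀ : 0 < t₀) (ht : 0 < t) :
    MemLp (fun s => truncatedPower m t₀ (t + s)) 2 (volume.restrict (Ioi (0 : ℝ))) := by
  refine (memLp_cutoff t₀ 1).of_le_mul (c := t₀ ^ m)
    ((measurable_truncatedPower m t₀).comp (measurable_const_add t)).aestronglyMeasurable ?_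
  filter_upwards [ae_restrict_mem measurableSet_Ioi] with s hs
  exact norm_truncatedPower_add_le ht₀ ht hs

/-- The integral defining the Hankel operator with kernel `truncatedPower m t₀`. -/
noncomputable def hankelIntegral (m : ℕ) (t₀ : ℝ) (v : ℝ → ℂ) (t : ℝ) : ℂ :=
  ∫ s in Ioi (0 : ℝ), truncatedPower m t₀ (t + s) * v s

theorem hankelIntegral_of_le (v : ℝ → ℂ) {t : ℝ} (h : t₀ ≤ t) : hankelIntegral m t₀ v t = 0 := by
  refine setIntegral_eq_zero_of_forall_eq_zero fun s hs => ?_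
  rw [truncatedPower_of_le m t₀ (by have := mem_Ioi.mp hs; linarith), zero_mul]

/-- Cauchy–Schwarz: as the kernel is real, the integral is an inner product of `v` with a slice of
the kernel. -/
theorem norm_hankelIntegral_le (ht₀ : 0 < t₀) (v : L2HalfLine) {t : ℝ} (ht : 0 < t) :
    ‖hankelIntegral m t₀ v t‖ ≤ t₀ ^ m * ‖cutoff t₀ 1‖ * ‖v‖ := by
  let k : L2HalfLine := (memLp_truncatedPower_add (m := m) ht₀ ht).toLp
  have h1 : hankelIntegral m t₀ v t = inner ℂ k v := by
    rw [L2.inner_def]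
    refine integral_congr_ae ?_
    filter_upwards [(memLp_truncatedPower_add (m := m) ht₀ ht).coeFn_toLp] with s hs
    rw [RCLike.inner_apply', hs, conj_truncatedPower]
  have h2 : ‖k‖ ≤ t₀ ^ m * ‖cutoff t₀ 1‖ := by
    refine Lp.norm_le_mul_norm_of_ae_le_mul ?_
    filter_upwards [(memLp_truncatedPower_add (m := m) ht₀ ht).coeFn_toLp, coeFn_cutoff t₀ 1,
      ae_restrict_mem measurableSet_Ioi] with s hs h1 hmem
    rw [hs, h1]
    exact norm_truncatedPower_add_le ht₀ ht hmem
  rw [h1]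
  exact (norm_inner_le_norm k v).trans (by gcongr)

theorem norm_hankelIntegral_le_indicator (ht₀ : 0 < t₀) (v : L2HalfLine) {t : ℝ} (ht : 0 < t) :
    ‖hankelIntegral m t₀ v t‖ ≤
      t₀ ^ m * ‖cutoff t₀ 1‖ * ‖v‖ * ‖(Ioc 0 t₀).indicator (1 : C(ℝ, ℂ)) t‖ := by
  by_cases h : t ≤ t₀
  · rw [indicator_of_mem (show t ∈ Ioc 0 t₀ from ⟨ht, h⟩)]
    simpa using norm_hankelIntegral_le ht₀ v ht
  · rw [hankelIntegral_of_le _ (not_le.mp h).le, norm_zero]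
    positivity

theorem integrable_truncatedPower_add_mul (ht₀ : 0 < t₀) (v : L2HalfLine) {t : ℝ} (ht : 0 < t) :
    IntegrableOn (fun s => truncatedPower m t₀ (t + s) * v s) (Ioi (0 : ℝ)) :=
  (memLp_truncatedPower_add ht₀ ht).integrable_mul (Lp.memLp v)

theorem aestronglyMeasurable_kernel (μ ν : Measure ℝ) [SFinite ν] {v : ℝ → ℂ}
    (hv : AEStronglyMeasurable v ν) :
    AEStronglyMeasurable (fun p : ℝ × ℝ => truncatedPower m t₀ (p.1 + p.2) * v p.2) (μ.prod ν) :=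
  ((measurable_truncatedPower m t₀).comp measurable_add).aestronglyMeasurable.mul hv.comp_snd

theorem memLp_hankelIntegral (ht₀ : 0 < t₀) (v : L2HalfLine) :
    MemLp (hankelIntegral m t₀ v) 2 (volume.restrict (Ioi (0 : ℝ))) := by
  refine (memLp_cutoff t₀ 1).of_le_mul (c := t₀ ^ m * ‖cutoff t₀ 1‖ * ‖v‖)
    (aestronglyMeasurable_kernel _ _ (Lp.aestronglyMeasurable v)).integral_prod_right' ?_
  filter_upwards [ae_restrict_mem measurableSet_Ioi] with t ht
  exact norm_hankelIntegral_le_indicator ht₀ v ht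

/-- The integral Hankel operator with kernel `truncatedPower m t₀`. -/
noncomputable def hankelOperator (m : ℕ) (ht₀ : 0 < t₀) : L2HalfLine →L[ℂ] L2HalfLine :=
  LinearMap.mkContinuous
    { toFun := fun v => (memLp_hankelIntegral (m := m) ht₀ v).toLp
      map_add' := fun v w => by
        rw [← MemLp.toLp_add, MemLp.toLp_eq_toLp_iff]
        filter_upwards [ae_restrict_mem measurableSet_Ioi] with t ht
        rw [Pi.add_apply, hankelIntegral, hankelIntegral, hankelIntegral,
          ← integral_add (integrable_truncatedPower_add_mul ht₀ v ht)
            (integrable_truncatedPower_add_mul ht₀ w ht)]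
        refine integral_congr_ae ?_
        filter_upwards [Lp.coeFn_add v w] with s hs
        rw [hs, Pi.add_apply, mul_add]
      map_smul' := fun c v => by
        rw [RingHom.id_apply, ← MemLp.toLp_const_smul, MemLp.toLp_eq_toLp_iff]
        filter_upwards [ae_restrict_mem measurableSet_Ioi] with t ht
        rw [Pi.smul_apply, hankelIntegral, hankelIntegral, ← integral_smul]
        refine integral_congr_ae ?_
        filter_upwards [Lp.coeFn_smul c v] with s hs
        rw [hs, Pi.smul_apply, mul_smul_comm] }
    -- One factor `‖cutoff t₀ 1‖` comes from Cauchy–Schwarz in `s`, the other from the support of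
    -- the image in `t`.
    (t₀ ^ m * ‖cutoff t₀ 1‖ * ‖cutoff t₀ 1‖)
    (fun v => by
      rw [mul_right_comm]
      refine Lp.norm_le_mul_norm_of_ae_le_mul ?_
      filter_upwards [(memLp_hankelIntegral (m := m) ht₀ v).coeFn_toLp, coeFn_cutoff t₀ 1,
        ae_restrict_mem measurableSet_Ioi] with t h1 h2 ht
      rw [LinearMap.coe_mk, AddHom.coe_mk, h1, h2]
      exact norm_hankelIntegral_le_indicator ht₀ v ht)

theorem coeFn_hankelOperator (ht₀ : 0 < t₀) (v : L2HalfLine) :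
    hankelOperator m ht₀ v =ᵐ[volume.restrict (Ioi (0 : ℝ))] hankelIntegral m t₀ v :=
  (memLp_hankelIntegral (m := m) ht₀ v).coeFn_toLp

theorem isHankelOperator_hankelOperator (ht₀ : 0 < t₀) :
    IsHankelOperator (truncatedPower m t₀) (hankelOperator m ht₀) where
  locallyIntegrableOn := by
    refine locallyIntegrableOn_of_locallyIntegrable_restrict
      ((locallyIntegrable_const (t₀ ^ m)).mono
        (measurable_truncatedPower m t₀).aestronglyMeasurable ?_)
    filter_upwards [ae_restrict_mem measurableSet_Ioi] with t ht
    exact (norm_truncatedPower_le ht₀ (mem_Ioi.mp ht).le).trans (le_abs_self _)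
  apply_test := by
    intro u _ _ _ f hf
    refine (coeFn_hankelOperator ht₀ f).trans (ae_of_all _ fun t => integral_congr_ae ?_)
    filter_upwards [hf] with s hs
    rw [hs]

/-- Test functions have dense span: an element orthogonal to all of them integrates to zero against
each, hence vanishes almost everywhere. -/
theorem IsHankelOperator.unique {h : ℝ → ℂ} {T T' : L2HalfLine →L[ℂ] L2HalfLine}
    (hT : IsHankelOperator h T) (hT' : IsHankelOperator h T') : T = T' := by
  let S : Set L2HalfLine := {f | ∃ u : ℝ → ℂ, ContDiff ℝ ∞ u ∧ HasCompactSupport u ∧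
    tsupport u ⊆ Ioi (0 : ℝ) ∧ (f : ℝ → ℂ) =ᵐ[volume.restrict (Ioi (0 : ℝ))] u}
  have hS : Dense (Submodule.span ℂ S : Set L2HalfLine) := by
    rw [Submodule.dense_iff_topologicalClosure_eq_top,
      Submodule.topologicalClosure_eq_top_iff, Submodule.eq_bot_iff]
    intro f hf
    have hloc : LocallyIntegrableOn f (Ioi (0 : ℝ)) volume :=
      locallyIntegrableOn_of_locallyIntegrable_restrict ((Lp.memLp f).locallyIntegrable one_le_two)
    have hz := isOpen_Ioi.ae_eq_zero_of_integral_contDiff_smul_eq_zero hloc fun g hg hgc hgs => by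
      have hu : ContDiff ℝ ∞ fun x => (g x : ℂ) := Complex.ofRealCLM.contDiff.comp hg
      have huc : HasCompactSupport fun x => (g x : ℂ) := hgc.comp_left Complex.ofReal_zero
      have hmem : MemLp (fun x => (g x : ℂ)) 2 (volume.restrict (Ioi (0 : ℝ))) :=
        (hu.continuous.memLp_of_hasCompactSupport huc).restrict _
      have hsupp : tsupport (fun x => (g x : ℂ)) ⊆ Ioi 0 :=
        (tsupport_comp_subset Complex.ofReal_zero g).trans hgs
      have h0 := hf hmem.toLp (Submodule.subset_span ⟨_, hu, huc, hsupp, hmem.coeFn_toLp⟩)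
      rw [L2.inner_def] at h0
      rw [← h0, ← setIntegral_eq_integral_of_forall_compl_eq_zero (s := Ioi (0 : ℝ))]
      · refine integral_congr_ae ?_
        filter_upwards [hmem.coeFn_toLp] with x hx
        rw [hx, RCLike.inner_apply', Complex.conj_ofReal, Complex.real_smul]
      · intro x hx
        rw [image_eq_zero_of_notMem_tsupport fun h => hx (hgs h), zero_smul]
    rw [Lp.eq_zero_iff_ae_eq_zero]
    exact (ae_restrict_iff' measurableSet_Ioi).mpr hz
  refine ContinuousLinearMap.ext_on hS ?_
  rintro f ⟨u, h1, h2, h3, h4⟩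
  exact Lp.ext ((hT.apply_test u h1 h2 h3 f h4).trans (hT'.apply_test u h1 h2 h3 f h4).symm)

end Hankel

/-! ### The Hankel operator as a Fourier multiplier modulo polynomials -/

section HankelFourier

open scoped ComplexConjugate

variable {m : ℕ} {t₀ : ℝ}

/-- The factor by which the Hankel operator multiplies the Fourier coefficient of index `n`. -/
noncomputable def hankelMultiplier (m : ℕ) (t₀ : ℝ) (n : ℤ) : ℂ :=
  m.factorial / (2 * Real.pi * Complex.I * ((-n : ℤ) : ℂ) / t₀) ^ (m + 1)

theorem norm_hankelMultiplier (ht₀ : 0 < t₀) (n : ℤ) :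
    ‖hankelMultiplier m t₀ n‖ = m.factorial * (t₀ / (2 * Real.pi * |(n : ℝ)|)) ^ (m + 1) := by
  rw [hankelMultiplier, norm_div, norm_pow, div_eq_mul_inv, ← inv_pow]
  congr 1
  · simp
  · congr 1
    simp [abs_of_pos Real.pi_pos, abs_of_pos ht₀]

/-- The kernel cuts the integral at `t₀ - s`. Evaluating the exponential of frequency `-n` at `t₀ -
s` gives, by periodicity, frequency `n` at `s`; hence the operator swaps the modes `n` and `-n`. -/
theorem integral_wave_mul_truncatedPower (m : ℕ) (ht₀ : 0 < t₀) (n : ℤ) :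
    ∃ P : Polynomial ℂ, P.natDegree ≤ m + 1 ∧ ∀ s ∈ Ioc 0 t₀,
      ∫ t in Ioc 0 t₀, wave t₀ (-n) t * truncatedPower m t₀ (t + s) =
        P.eval (s : ℂ) + hankelMultiplier m t₀ n * wave t₀ n s := by
  obtain ⟨P, hP, h⟩ := exists_polynomial_integral_exp_mul_pow m
    (2 * Real.pi * Complex.I * ((-n : ℤ) : ℂ) / t₀)
  refine ⟨P.comp (Polynomial.C (t₀ : ℂ) - Polynomial.X), ?_, fun s hs => ?_⟩
  · refine Polynomial.natDegree_comp_le.trans ?_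
    have : (Polynomial.C (t₀ : ℂ) - Polynomial.X).natDegree ≤ 1 :=
      (Polynomial.natDegree_sub_le _ _).trans (by simp)
    calc _ ≤ P.natDegree * 1 := Nat.mul_le_mul_left _ this
      _ ≤ m + 1 := by omega
  · have h1 : ∫ t in Ioc 0 t₀, wave t₀ (-n) t * truncatedPower m t₀ (t + s) =
        ∫ t in Ioo 0 (t₀ - s), wave t₀ (-n) t * truncatedPower m t₀ (t + s) := by
      refine setIntegral_eq_of_subset_of_forall_sdiff_eq_zero measurableSet_Ioc ?_ ?_
      · exact fun t ht => ⟨ht.1, by linarith [ht.2, hs.1]⟩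
      · intro t ht
        have : t₀ - s ≤ t := by
          by_contra! h
          exact ht.2 ⟨ht.1.1, h⟩
        rw [truncatedPower_of_le m t₀ (by linarith), mul_zero]
    have h2 : ∫ t in Ioo 0 (t₀ - s), wave t₀ (-n) t * truncatedPower m t₀ (t + s) =
        ∫ t in Ioo 0 (t₀ - s), Complex.exp (2 * Real.pi * Complex.I * ((-n : ℤ) : ℂ) / t₀ * t) *
          ((t₀ - s - t : ℝ) : ℂ) ^ m := by
      refine setIntegral_congr_fun measurableSet_Ioo fun t ht => ?_
      rw [truncatedPower_of_lt m t₀ (by linarith [ht.2])]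
      simp only [wave, ContinuousMap.coe_mk]
      congr 3
      ring
    rw [h1, h2, ← integral_Ioc_eq_integral_Ioo,
      ← intervalIntegral.integral_of_le (by linarith [hs.2]), h, hankelMultiplier]
    congr 1
    · simp
    · congr 1
      have h3 : (t₀ : ℂ) ≠ 0 := by exact_mod_cast ht₀.ne'
      have h4 : 2 * Real.pi * Complex.I * ((-n : ℤ) : ℂ) / t₀ * ((t₀ - s : ℝ) : ℂ) =
          ((-n : ℤ) : ℂ) * (2 * Real.pi * Complex.I) + 2 * Real.pi * Complex.I * n / t₀ * s := by
        push_cast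
        field_simp
        ring
      rw [h4, Complex.exp_add, Complex.exp_int_mul_two_pi_mul_I, one_mul]
      rfl

theorem hankelIntegral_eq_integral_Ioc (v : ℝ → ℂ) {t : ℝ} (ht : 0 < t) :
    hankelIntegral m t₀ v t = ∫ s in Ioc 0 t₀, truncatedPower m t₀ (t + s) * v s := by
  refine setIntegral_eq_of_subset_of_forall_sdiff_eq_zero measurableSet_Ioi Ioc_subset_Ioi_self ?_
  intro s hs
  have : t₀ < s := by
    by_contra! h
    exact hs.2 ⟨hs.1, h⟩
  rw [truncatedPower_of_le m t₀ (by linarith), zero_mul]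

theorem fourierInt_hankelIntegral (ht₀ : 0 < t₀) (v : L2HalfLine) (n : ℤ) :
    fourierInt t₀ (hankelIntegral m t₀ v) n =
      ∫ s in Ioc 0 t₀, v s * ∫ t in Ioc 0 t₀, wave t₀ (-n) t * truncatedPower m t₀ (t + s) := by
  have h1 : fourierInt t₀ (hankelIntegral m t₀ v) n =
      ∫ t in Ioc 0 t₀, ∫ s in Ioc 0 t₀, wave t₀ (-n) t * (truncatedPower m t₀ (t + s) * v s) := by
    refine setIntegral_congr_fun measurableSet_Ioc fun t ht => ?_
    rw [hankelIntegral_eq_integral_Ioc _ ht.1, ← integral_const_mul]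
  rw [h1, integral_integral_swap]
  · refine integral_congr_ae (ae_of_all _ fun s => ?_)
    simp only
    rw [← integral_const_mul]
    refine integral_congr_ae (ae_of_all _ fun t => ?_)
    simp only
    ring
  · have hv := (integrableOn_Ioc t₀ v).comp_snd (volume.restrict (Ioc 0 t₀))
    have hk : AEStronglyMeasurable
        (fun p : ℝ × ℝ => wave t₀ (-n) p.1 * truncatedPower m t₀ (p.1 + p.2))
        ((volume.restrict (Ioc 0 t₀)).prod (volume.restrict (Ioc 0 t₀))) :=
      (((wave t₀ (-n)).continuous.measurable.comp measurable_fst).mul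
        ((measurable_truncatedPower m t₀).comp measurable_add)).aestronglyMeasurable
    have hb : ∀ᵐ p : ℝ × ℝ ∂((volume.restrict (Ioc 0 t₀)).prod (volume.restrict (Ioc 0 t₀))),
        ‖wave t₀ (-n) p.1 * truncatedPower m t₀ (p.1 + p.2)‖ ≤ t₀ ^ m := by
      rw [Measure.prod_restrict]
      filter_upwards [ae_restrict_mem (measurableSet_Ioc.prod measurableSet_Ioc)] with p hp
      have hw : ‖wave t₀ (-n) p.1‖ = 1 := by
        have : 2 * Real.pi * Complex.I * ((-n : ℤ) : ℂ) / t₀ * p.1 =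
            ((2 * Real.pi * (-n : ℤ) / t₀ * p.1 : ℝ) : ℂ) * Complex.I := by
          push_cast
          ring
        rw [wave, ContinuousMap.coe_mk, this, Complex.norm_exp_ofReal_mul_I]
      rw [norm_mul, hw, one_mul]
      exact norm_truncatedPower_le ht₀ (add_pos hp.1.1 hp.2.1).le
    refine (hv.bdd_mul hk hb).congr (ae_of_all _ fun p => ?_)
    simp only [Function.uncurry]
    ring

theorem integral_mul_polynomial_eq_zero {v : L2HalfLine} {k : ℕ}
    (hv : ∀ j < k, inner ℂ (cutoff t₀ (monomialMap j)) v = 0) {P : Polynomial ℂ}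
    (hP : P.natDegree < k) : ∫ s in Ioc 0 t₀, v s * P.eval (s : ℂ) = 0 := by
  have hint : ∀ j, IntegrableOn (fun s : ℝ => conj (monomialMap j s) * v s) (Ioc 0 t₀) := by
    intro j
    refine (integrableOn_Ioc t₀ v).bdd_mul (c := t₀ ^ j)
      (Complex.continuous_conj.comp (monomialMap j).continuous).aestronglyMeasurable ?_
    filter_upwards [ae_restrict_mem measurableSet_Ioc] with s hs
    simp only [monomialMap, ContinuousMap.coe_mk, RCLike.norm_conj, norm_pow, Complex.norm_real,
      Real.norm_of_nonneg hs.1.le]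
    exact pow_le_pow_left₀ hs.1.le hs.2 j
  have h1 : ∀ s : ℝ, v s * P.eval (s : ℂ) =
      ∑ j ∈ Finset.range k, P.coeff j * (conj (monomialMap j s) * v s) := by
    intro s
    rw [Polynomial.eval_eq_sum_range' hP, Finset.mul_sum]
    refine Finset.sum_congr rfl fun j _ => ?_
    simp only [monomialMap, ContinuousMap.coe_mk, map_pow, Complex.conj_ofReal]
    ring
  simp only [h1]
  rw [integral_finsetSum _ fun j _ => (hint j).const_mul _]
  refine Finset.sum_eq_zero fun j hj => ?_
  rw [integral_const_mul, ← inner_cutoff, hv j (Finset.mem_range.mp hj), mul_zero]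

/-- After Fubini, the polynomial part has degree at most `m + 1` and is killed by the `m + 2`
orthogonality conditions. At `n = 0` the multiplier is `0`, in accordance with the integral being
purely polynomial. -/
theorem fourierInt_hankelOperator (ht₀ : 0 < t₀) {v : L2HalfLine}
    (hv : ∀ j < m + 2, inner ℂ (cutoff t₀ (monomialMap j)) v = 0) (n : ℤ) :
    fourierInt t₀ (hankelOperator m ht₀ v) n = hankelMultiplier m t₀ n * fourierInt t₀ v (-n) := by
  have h0 := ae_restrict_of_ae (s := Ioc 0 t₀) (coeFn_hankelOperator (m := m) ht₀ v)
  rw [restrict_Ioi_restrict_Ioc] at h0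
  obtain ⟨P, hP, h⟩ := integral_wave_mul_truncatedPower m ht₀ n
  rw [fourierInt_congr h0, fourierInt_hankelIntegral ht₀]
  have h1 : ∫ s in Ioc 0 t₀, v s * ∫ t in Ioc 0 t₀, wave t₀ (-n) t * truncatedPower m t₀ (t + s) =
      ∫ s in Ioc 0 t₀, (v s * P.eval (s : ℂ) + hankelMultiplier m t₀ n * (wave t₀ n s * v s)) := by
    refine setIntegral_congr_fun measurableSet_Ioc fun s hs => ?_
    rw [h s hs]
    ring
  have hbound : ∀ g : ℝ → ℂ, Continuous g → IntegrableOn (fun s => g s * v s) (Ioc 0 t₀) := by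
    intro g hg
    obtain ⟨C, hC⟩ := isCompact_Icc.exists_bound_of_continuousOn (s := Icc 0 t₀) hg.continuousOn
    refine (integrableOn_Ioc t₀ v).bdd_mul (c := C) hg.aestronglyMeasurable ?_
    filter_upwards [ae_restrict_mem measurableSet_Ioc] with s hs
    exact hC s (Ioc_subset_Icc_self hs)
  rw [h1, integral_add, integral_mul_polynomial_eq_zero hv (by omega), zero_add, integral_const_mul,
    fourierInt, neg_neg]
  · simp only [mul_comm (v _)]
    exact hbound _ (P.continuous.comp Complex.continuous_ofReal)
  · exact (hbound _ (wave t₀ n).continuous).const_mul _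

theorem hankelOperator_eq_zero_of_lt (ht₀ : 0 < t₀) (v : L2HalfLine) :
    ∀ᵐ x ∂volume.restrict (Ioi (0 : ℝ)), t₀ < x → hankelOperator m ht₀ v x = 0 := by
  filter_upwards [coeFn_hankelOperator ht₀ v] with x hx h
  rw [hx, hankelIntegral_of_le _ h.le]

theorem hasSum_hankelOperator (ht₀ : 0 < t₀) {v : L2HalfLine}
    (hv : ∀ j < m + 2, inner ℂ (cutoff t₀ (monomialMap j)) v = 0) :
    HasSum (fun n => ‖hankelMultiplier m t₀ n‖ ^ 2 * ‖fourierInt t₀ v n‖ ^ 2)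
      (t₀ * ‖hankelOperator m ht₀ v‖ ^ 2) := by
  have h := hasSum_sq_fourierInt ht₀ (hankelOperator m ht₀ v)
  rw [integral_Ioc_norm_sq_eq (hankelOperator_eq_zero_of_lt ht₀ v)] at h
  -- The swap of `n` and `-n` is absorbed by reindexing, since the modulus of the multiplier is
  -- even.
  rw [← (Equiv.neg ℤ).hasSum_iff]
  convert h using 2 with n
  rw [fourierInt_hankelOperator ht₀ hv, norm_mul, mul_pow]
  simp [norm_hankelMultiplier ht₀]

theorem norm_hankelOperator_le (ht₀ : 0 < t₀) {v : L2HalfLine}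
    (hv : ∀ j < m + 2, inner ℂ (cutoff t₀ (monomialMap j)) v = 0) {C : ℝ} (hC : 0 ≤ C)
    (h : ∀ n, fourierInt t₀ v n ≠ 0 → ‖hankelMultiplier m t₀ n‖ ≤ C) :
    ‖hankelOperator m ht₀ v‖ ≤ C * ‖v‖ := by
  have h1 := hasSum_hankelOperator ht₀ hv
  have h2 := (hasSum_sq_fourierInt ht₀ v).mul_left (C ^ 2)
  have h3 := hasSum_le (fun n => ?_) h1 h2
  · have h4 := integral_Ioc_norm_sq_le t₀ v
    refine (sq_le_sq₀ (norm_nonneg _) (by positivity)).mp (le_of_mul_le_mul_left ?_ ht₀)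
    calc _ ≤ _ := h3
      _ ≤ C ^ 2 * (t₀ * ‖v‖ ^ 2) := by gcongr
      _ = _ := by ring
  · by_cases h0 : fourierInt t₀ v n = 0
    · simp [h0]
    · have := h n h0
      gcongr

/-- Mass of `v` beyond `t₀` is invisible to the operator, hence the support condition, which the
upper bound does not need. -/
theorem le_norm_hankelOperator (ht₀ : 0 < t₀) {v : L2HalfLine}
    (hv : ∀ j < m + 2, inner ℂ (cutoff t₀ (monomialMap j)) v = 0)
    (hsupp : ∀ᵐ x ∂volume.restrict (Ioi (0 : ℝ)), t₀ < x → v x = 0) {C : ℝ} (hC : 0 ≤ C)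
    (h : ∀ n, fourierInt t₀ v n ≠ 0 → C ≤ ‖hankelMultiplier m t₀ n‖) :
    C * ‖v‖ ≤ ‖hankelOperator m ht₀ v‖ := by
  have h1 := hasSum_hankelOperator ht₀ hv
  have h2 := (hasSum_sq_fourierInt ht₀ v).mul_left (C ^ 2)
  rw [integral_Ioc_norm_sq_eq hsupp] at h2
  have h3 := hasSum_le (fun n => ?_) h2 h1
  · refine (sq_le_sq₀ (by positivity) (norm_nonneg _)).mp (le_of_mul_le_mul_left ?_ ht₀)
    calc _ = C ^ 2 * (t₀ * ‖v‖ ^ 2) := by ring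
      _ ≤ _ := h3
  · by_cases h0 : fourierInt t₀ v n = 0
    · simp [h0]
    · have := h n h0
      gcongr

end HankelFourier

/-! ### Trial subspaces and the asymptotics -/

section HankelSingularValues

variable {m : ℕ} {t₀ : ℝ}

/-- The span of the monomials of degree less than `k`, cut off outside `(0, t₀]`. -/
noncomputable def monomialSpan (k : ℕ) (t₀ : ℝ) : Submodule ℂ L2HalfLine :=
  Submodule.span ℂ (range fun j : Fin k => cutoff t₀ (monomialMap j))

/-- The span of the exponentials with frequencies in `F`, cut off outside `(0, t₀]`. -/
noncomputable def waveSpan (F : Finset ℤ) (t₀ : ℝ) : Submodule ℂ L2HalfLine :=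
  Submodule.span ℂ (range fun n : F => cutoff t₀ (wave t₀ n))

instance (k : ℕ) : FiniteDimensional ℂ (monomialSpan k t₀) :=
  FiniteDimensional.span_of_finite ℂ (finite_range _)

instance (F : Finset ℤ) : FiniteDimensional ℂ (waveSpan F t₀) :=
  FiniteDimensional.span_of_finite ℂ (finite_range _)

theorem finrank_monomialSpan_le (k : ℕ) : Module.finrank ℂ (monomialSpan k t₀) ≤ k :=
  (finrank_range_le_card _).trans (Fintype.card_fin k).le

theorem finrank_waveSpan (ht₀ : 0 < t₀) (F : Finset ℤ) :
    Module.finrank ℂ (waveSpan F t₀) = F.card := by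
  rw [waveSpan, finrank_span_eq_card, Fintype.card_coe]
  refine linearIndependent_of_ne_zero_of_inner_eq_zero (fun n h => ?_) fun n k hnk => ?_
  · have := inner_cutoff_wave_wave ht₀ n n
    rw [h, inner_zero_left, if_pos rfl] at this
    exact ht₀.ne (by exact_mod_cast this)
  · exact (inner_cutoff_wave_wave ht₀ _ _).trans (if_neg fun h => hnk (Subtype.ext h))

theorem inner_monomial_eq_zero {k : ℕ} {v : L2HalfLine} (hv : v ∈ (monomialSpan k t₀)ᗮ) :
    ∀ j < k, inner ℂ (cutoff t₀ (monomialMap j)) v = 0 :=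
  fun j hj => hv _ (Submodule.subset_span ⟨⟨j, hj⟩, rfl⟩)

theorem fourierInt_eq_zero_of_mem_orthogonal {F : Finset ℤ} {v : L2HalfLine}
    (hv : v ∈ (waveSpan F t₀)ᗮ) {n : ℤ} (hn : n ∈ F) : fourierInt t₀ v n = 0 := by
  rw [← inner_cutoff_wave]
  exact hv _ (Submodule.subset_span ⟨⟨n, hn⟩, rfl⟩)

theorem fourierInt_eq_zero_of_mem_waveSpan (ht₀ : 0 < t₀) {F : Finset ℤ} {v : L2HalfLine}
    (hv : v ∈ waveSpan F t₀) {n : ℤ} (hn : n ∉ F) : fourierInt t₀ v n = 0 := by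
  rw [← inner_cutoff_wave]
  have : waveSpan F t₀ ≤ (ℂ ∙ cutoff t₀ (wave t₀ n))ᗮ := by
    refine Submodule.span_le.mpr ?_
    rintro _ ⟨k, rfl⟩
    refine Submodule.mem_orthogonal_singleton_iff_inner_right.mpr ?_
    rw [inner_cutoff_wave_wave ht₀, if_neg fun h => hn (by rw [h]; exact k.2)]
  exact Submodule.mem_orthogonal_singleton_iff_inner_right.mp (this hv)

theorem eq_zero_of_lt_of_mem_waveSpan {F : Finset ℤ} {v : L2HalfLine} (hv : v ∈ waveSpan F t₀) :
    ∀ᵐ x ∂volume.restrict (Ioi (0 : ℝ)), t₀ < x → v x = 0 := by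
  induction hv using Submodule.span_induction with
  | mem v hv =>
    obtain ⟨n, rfl⟩ := hv
    filter_upwards [coeFn_cutoff t₀ (wave t₀ n)] with x hx h
    rw [hx, indicator_of_notMem fun h' => h'.2.not_gt h]
  | zero =>
    filter_upwards [Lp.coeFn_zero ℂ 2 (volume.restrict (Ioi (0 : ℝ)))] with x hx h
    rw [hx, Pi.zero_apply]
  | add v w _ _ h1 h2 =>
    filter_upwards [h1, h2, Lp.coeFn_add v w] with x h1 h2 hx h
    rw [hx, Pi.add_apply, h1 h, h2 h, add_zero]
  | smul c v _ h1 =>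
    filter_upwards [h1, Lp.coeFn_smul c v] with x h1 hx h
    rw [hx, Pi.smul_apply, h1 h, smul_zero]

/-- The modulus of the Fourier multiplier at the frequencies `± N`. -/
noncomputable def hankelBound (m : ℕ) (t₀ : ℝ) (N : ℕ) : ℝ :=
  m.factorial * (t₀ / (2 * Real.pi * N)) ^ (m + 1)

theorem hankelBound_nonneg (ht₀ : 0 < t₀) (N : ℕ) : 0 ≤ hankelBound m t₀ N := by
  have := Real.pi_pos
  unfold hankelBound
  positivity

theorem norm_hankelOperator_le_of_mem_orthogonal (ht₀ : 0 < t₀) (N : ℕ) {v : L2HalfLine}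
    (hv : v ∈ (monomialSpan (m + 2) t₀ ⊔ waveSpan (Finset.Icc (-N : ℤ) N) t₀)ᗮ) :
    ‖hankelOperator m ht₀ v‖ ≤ hankelBound m t₀ (N + 1) * ‖v‖ := by
  have hv1 := Submodule.orthogonal_le le_sup_left hv
  have hv2 := Submodule.orthogonal_le le_sup_right hv
  refine norm_hankelOperator_le ht₀ (inner_monomial_eq_zero hv1) (hankelBound_nonneg ht₀ _) ?_
  intro n hn
  have hnF : n ∉ Finset.Icc (-N : ℤ) N := fun h => hn (fourierInt_eq_zero_of_mem_orthogonal hv2 h)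
  have hn1 : ((N : ℤ) + 1) ≤ |n| := by
    by_contra! h
    exact hnF (Finset.mem_Icc.mpr (abs_le.mp (by omega)))
  have hn2 : ((N + 1 : ℕ) : ℝ) ≤ |(n : ℝ)| := by
    rw [← Int.cast_abs]
    exact_mod_cast hn1
  have := Real.pi_pos
  rw [norm_hankelMultiplier ht₀, hankelBound]
  have : (0 : ℝ) < ((N + 1 : ℕ) : ℝ) := by positivity
  gcongr

/-- Frequency `0` must be left out because its multiplier is `0`. -/
theorem le_norm_hankelOperator_of_mem (ht₀ : 0 < t₀) (N : ℕ) {v : L2HalfLine}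
    (hv : v ∈ waveSpan ((Finset.Icc (-N : ℤ) N).erase 0) t₀ ⊓ (monomialSpan (m + 2) t₀)ᗮ) :
    hankelBound m t₀ N * ‖v‖ ≤ ‖hankelOperator m ht₀ v‖ := by
  refine le_norm_hankelOperator ht₀ (inner_monomial_eq_zero hv.2)
    (eq_zero_of_lt_of_mem_waveSpan hv.1) (hankelBound_nonneg ht₀ _) fun n hn => ?_
  have hnF : n ∈ (Finset.Icc (-N : ℤ) N).erase 0 := by
    by_contra h
    exact hn (fourierInt_eq_zero_of_mem_waveSpan ht₀ hv.1 h)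
  rw [Finset.mem_erase, Finset.mem_Icc, ← abs_le] at hnF
  have hn1 : (0 : ℝ) < |(n : ℝ)| := abs_pos.mpr (by exact_mod_cast hnF.1)
  have hn2 : |(n : ℝ)| ≤ N := by
    rw [← Int.cast_abs]
    exact_mod_cast hnF.2
  have := Real.pi_pos
  rw [norm_hankelMultiplier ht₀, hankelBound]
  gcongr

theorem isApproxFinite_hankelOperator (m : ℕ) (ht₀ : 0 < t₀) :
    IsApproxFinite (hankelOperator m ht₀) := by
  intro ε hε
  have h1 : Tendsto (hankelBound m t₀) atTop (𝓝 0) := by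
    have h2 : Tendsto (fun N : ℕ => t₀ / (2 * Real.pi * N)) atTop (𝓝 0) := by
      simp only [← div_div]
      exact tendsto_const_div_atTop_nhds_zero_nat _
    unfold hankelBound
    simpa using (h2.pow (m + 1)).const_mul (m.factorial : ℝ)
  obtain ⟨N, hN⟩ := ((h1.comp (tendsto_add_atTop_nat 1)).eventually_le_const hε).exists
  refine ⟨monomialSpan (m + 2) t₀ ⊔ waveSpan (Finset.Icc (-N : ℤ) N) t₀, inferInstance,
    fun v hv => (norm_hankelOperator_le_of_mem_orthogonal ht₀ N hv).trans ?_⟩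
  gcongr
  exact hN

variable {s : ℕ+ → ℝ}

/-- The excluded subspace has dimension at most `(m + 2) + (2N + 1)`. -/
theorem singularValue_hankelOperator_le (ht₀ : 0 < t₀)
    (hs : IsSingularValueSequence (hankelOperator m ht₀) s) {N : ℕ} {n : ℕ+}
    (hn : 2 * N + m + 3 < n) : s n ≤ hankelBound m t₀ (N + 1) := by
  refine (isApproxFinite_hankelOperator m ht₀).singularValue_le hs
    (monomialSpan (m + 2) t₀ ⊔ waveSpan (Finset.Icc (-N : ℤ) N) t₀) (hankelBound_nonneg ht₀ _)
    (fun v hv => norm_hankelOperator_le_of_mem_orthogonal ht₀ N hv) ?_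
  have h1 := Submodule.finrank_add_le_finrank_add_finrank (monomialSpan (m + 2) t₀)
    (waveSpan (Finset.Icc (-N : ℤ) N) t₀)
  have h2 := finrank_monomialSpan_le (t₀ := t₀) (m + 2)
  rw [finrank_waveSpan ht₀, Int.card_Icc] at h1
  omega

/-- Of the `2N` nonzero frequencies, orthogonality to polynomials costs at most `m + 2` dimensions.
-/
theorem le_singularValue_hankelOperator (ht₀ : 0 < t₀)
    (hs : IsSingularValueSequence (hankelOperator m ht₀) s) {N : ℕ} {n : ℕ+}
    (hn : n + m + 2 ≤ 2 * N) : hankelBound m t₀ N ≤ s n := by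
  have hfin : FiniteDimensional ℂ (waveSpan ((Finset.Icc (-N : ℤ) N).erase 0) t₀ ⊓
      (monomialSpan (m + 2) t₀)ᗮ : Submodule ℂ L2HalfLine) :=
    Submodule.finiteDimensional_of_le inf_le_left
  refine (isApproxFinite_hankelOperator m ht₀).le_singularValue hs
    (waveSpan ((Finset.Icc (-N : ℤ) N).erase 0) t₀ ⊓ (monomialSpan (m + 2) t₀)ᗮ)
    (fun v hv => le_norm_hankelOperator_of_mem ht₀ N hv) ?_
  have h1 := (waveSpan ((Finset.Icc (-N : ℤ) N).erase 0) t₀).finrank_le_finrank_inf_orthogonal_add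
    (monomialSpan (m + 2) t₀)
  have h2 := finrank_monomialSpan_le (t₀ := t₀) (m + 2)
  rw [finrank_waveSpan ht₀, Finset.card_erase_of_mem (by simp), Int.card_Icc] at h1
  omega

/-- A sequence squeezed between shifts of `n ^ p` is asymptotic to `n ^ p` with relative error
`O(1 / n)`. -/
theorem abs_sub_one_le_of_shift_bounds {p : ℕ} {n q x : ℝ} (hq : 0 ≤ q) (hn : q < n)
    (hn' : 2 * (p * q) ≤ n) (hlow : (n / (n + q)) ^ p ≤ x) (hup : x ≤ (n / (n - q)) ^ p) :
    |x - 1| ≤ 2 * (p * q) / n := by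
  have hn0 : 0 < n := hq.trans_lt hn
  have hpq : 0 ≤ p * q / n := by positivity
  have hy : p * q / n ≤ 1 / 2 := by
    rw [div_le_iff₀ hn0]
    linarith
  have e : 2 * (p * q) / n = 2 * (p * q / n) := by ring
  rw [abs_le, e]
  constructor
  · have h1 : n / (n + q) = 1 + -(q / (n + q)) := by
      field_simp
      ring
    have h2 : q / (n + q) ≤ 1 := div_le_one_of_le₀ (by linarith) (by linarith)
    -- Bernoulli's inequality; the upper bound applies it to the reciprocal and then uses `(1 - y)⁻¹
    -- ≤ 1 + 2y` for `0 ≤ y ≤ 1/2`.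
    have h3 := one_add_mul_le_pow (a := -(q / (n + q))) (by linarith) p
    rw [← h1] at h3
    have h4 : p * (q / (n + q)) ≤ p * q / n := by
      rw [mul_div_assoc]
      gcongr
      linarith
    linarith
  · have hnq : 0 < n - q := sub_pos.mpr hn
    have h1 : n / (n - q) = (1 + -(q / n))⁻¹ := by
      have : 1 + -(q / n) = (n - q) / n := by
        field_simp
        ring
      rw [this, inv_div]
    have h2 : q / n ≤ 1 := div_le_one_of_le₀ hn.le hn0.le
    have h3 := one_add_mul_le_pow (a := -(q / n)) (by linarith) p
    have h4 : (p : ℝ) * -(q / n) = -(p * q / n) := by ring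
    rw [h4] at h3
    have h5 : (n / (n - q)) ^ p ≤ (1 + -(p * q / n))⁻¹ := by
      rw [h1, inv_pow]
      exact inv_anti₀ (by linarith) h3
    have h6 : (1 + -(p * q / n))⁻¹ ≤ 1 + 2 * (p * q / n) := by
      rw [inv_le_iff_one_le_mul₀ (by linarith)]
      nlinarith
    linarith

theorem singularValue_hankelOperator_asymptotics (ht₀ : 0 < t₀)
    (hs : IsSingularValueSequence (hankelOperator m ht₀) s) :
    ∃ r : ℕ+ → ℝ, r =O[atTop] (fun n : ℕ+ => ((n : ℕ) : ℝ)⁻¹) ∧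
      ∀ n : ℕ+, s n = (m.factorial : ℝ) * t₀ ^ (m + 1) *
        (Real.pi * ((n : ℕ) : ℝ)) ^ (-(m : ℤ) - 1) * (1 + r n) := by
  have hπ := Real.pi_pos
  let D : ℕ+ → ℝ := fun n =>
    (m.factorial : ℝ) * t₀ ^ (m + 1) * (Real.pi * ((n : ℕ) : ℝ)) ^ (-(m : ℤ) - 1)
  have hD : ∀ n : ℕ+, D n = m.factorial * (t₀ / (Real.pi * ((n : ℕ) : ℝ))) ^ (m + 1) := by
    intro n
    have : (-(m : ℤ) - 1) = -((m + 1 : ℕ) : ℤ) := by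
      push_cast
      ring
    simp only [D, this, zpow_neg, zpow_natCast, div_pow]
    ring
  have hpos : ∀ n : ℕ+, 0 < D n := by
    intro n
    have : (0 : ℝ) < ((n : ℕ) : ℝ) := by exact_mod_cast n.pos
    rw [hD]
    positivity
  refine ⟨fun n => s n / D n - 1, ?_, fun n => ?_⟩
  · refine IsBigO.of_bound (2 * (((m + 1 : ℕ) : ℝ) * (m + 3))) ?_
    filter_upwards [eventually_ge_atTop
      (⟨2 * ((m + 1) * (m + 3)) + (m + 4), by omega⟩ : ℕ+)] with n hn
    have hn1 : 2 * ((m + 1) * (m + 3)) + (m + 4) ≤ (n : ℕ) := hn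
    have hnR : (2 * ((m + 1) * (m + 3)) + (m + 4) : ℝ) ≤ ((n : ℕ) : ℝ) := by exact_mod_cast hn1
    have hn0 : (0 : ℝ) < ((n : ℕ) : ℝ) := by exact_mod_cast n.pos
    have hm : (0 : ℝ) ≤ m := m.cast_nonneg
    have hprod : (0 : ℝ) ≤ (m + 1) * (m + 3) := by positivity
    rw [Real.norm_eq_abs, norm_inv, Real.norm_of_nonneg hn0.le, ← div_eq_mul_inv]
    refine abs_sub_one_le_of_shift_bounds (by positivity) (by linarith)
      (by push_cast; linarith) ?_ ?_
    · rw [le_div_iff₀ (hpos n)]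
      -- The least admissible `N`; rounding gives `2N ≤ n + (m + 3)`, a shift by `q = m + 3`.
      have h1 := le_singularValue_hankelOperator ht₀ hs (N := ((n : ℕ) + m + 3) / 2) (n := n)
        (by omega)
      refine le_trans ?_ h1
      have h2 : (2 * (((n : ℕ) + m + 3) / 2 : ℕ) : ℝ) ≤ ((n : ℕ) : ℝ) + (m + 3) := by
        have : 2 * (((n : ℕ) + m + 3) / 2) ≤ (n : ℕ) + (m + 3) := by omega
        exact_mod_cast this
      have h3 : (0 : ℝ) < ((((n : ℕ) + m + 3) / 2 : ℕ) : ℝ) := by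
        have : 0 < ((n : ℕ) + m + 3) / 2 := by omega
        exact_mod_cast this
      rw [hD, hankelBound, mul_left_comm, ← mul_pow]
      gcongr
      rw [div_mul_div_comm, mul_comm ((n : ℕ) : ℝ) t₀, mul_comm _ (Real.pi * _), mul_assoc Real.pi,
        mul_comm ((n : ℕ) : ℝ), ← mul_assoc Real.pi, mul_div_mul_right _ _ hn0.ne',
        mul_comm 2 Real.pi, mul_assoc Real.pi]
      gcongr
    · rw [div_le_iff₀ (hpos n)]
      -- The largest admissible `N`; rounding gives `2(N + 1) ≥ n - (m + 3)`, the same shift. The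
      -- subtraction is genuine because `n ≥ m + 4`.
      have h1 := singularValue_hankelOperator_le ht₀ hs (N := ((n : ℕ) - m - 4) / 2) (n := n)
        (by omega)
      refine h1.trans ?_
      have h2 : ((n : ℕ) : ℝ) - (m + 3) ≤ 2 * ((((n : ℕ) - m - 4) / 2 + 1 : ℕ) : ℝ) := by
        have : (n : ℕ) ≤ 2 * (((n : ℕ) - m - 4) / 2 + 1) + (m + 3) := by omega
        have : ((n : ℕ) : ℝ) ≤ 2 * ((((n : ℕ) - m - 4) / 2 + 1 : ℕ) : ℝ) + (m + 3) := by
          exact_mod_cast this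
        linarith
      have h3 : (0 : ℝ) < ((n : ℕ) : ℝ) - (m + 3) := by linarith
      rw [hD, hankelBound, mul_left_comm, ← mul_pow]
      gcongr
      rw [div_mul_div_comm, mul_comm ((n : ℕ) : ℝ) t₀, mul_comm _ (Real.pi * _), mul_assoc Real.pi,
        mul_comm ((n : ℕ) : ℝ), ← mul_assoc Real.pi, mul_div_mul_right _ _ hn0.ne',
        mul_comm 2 Real.pi, mul_assoc Real.pi]
      gcongr
  · change s n = D n * (1 + (s n / D n - 1))
    rw [add_sub_cancel, mul_div_cancel₀ _ (hpos n).ne']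

end HankelSingularValues

theorem mainTheorem7 (m : ℕ) (t₀ : ℝ) (ht₀ : 0 < t₀) :
    (∃! T : L2HalfLine →L[ℂ] L2HalfLine, IsHankelOperator (truncatedPower m t₀) T) ∧
    ∀ T : L2HalfLine →L[ℂ] L2HalfLine, IsHankelOperator (truncatedPower m t₀) T →
      IsCompactOperator T ∧
      (∃! s : ℕ+ → ℝ, IsSingularValueSequence T s) ∧
      ∀ s : ℕ+ → ℝ, IsSingularValueSequence T s →
        ∃ r : ℕ+ → ℝ, r =O[atTop] (fun n : ℕ+ => ((n : ℕ) : ℝ)⁻¹) ∧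
          ∀ n : ℕ+, s n = (m.factorial : ℝ) * t₀ ^ (m + 1) *
            (Real.pi * ((n : ℕ) : ℝ)) ^ (-(m : ℤ) - 1) * (1 + r n) := by
  have h0 : IsHankelOperator (truncatedPower m t₀) (hankelOperator m ht₀) :=
    isHankelOperator_hankelOperator ht₀
  refine ⟨⟨_, h0, fun T hT => hT.unique h0⟩, fun T hT => ?_⟩
  rw [hT.unique h0]
  have happ := isApproxFinite_hankelOperator m ht₀
  exact ⟨happ.isCompactOperator, happ.existsUnique_isSingularValueSequence,
    fun s hs => singularValue_hankelOperator_asymptotics ht₀ hs⟩
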